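/- Let $L$ be a connected closed smooth manifold with base point $p$, and let $\hat h:\pi_1(L,p)\to\operatorname{Diffeo}^+(\mathbb R,0)$ be a homomorphism to the group of orientation preserving diffeomorphisms of $\mathbb R$ fixing $0$, whose image consists of homotheties $x\mapsto ax$ ($a>0$). Let $\pi:(\widetilde L,\tilde p)\to(L,p)$ be the connected pointed smooth regular covering with $\pi_*\pi_1(\widetilde L,\tilde p)=\ker\hat h$, let $\Gamma=\operatorname{Aut}(\pi)\equiv\pi_1(L,p)/\ker\hat h$ be its group of deck transformations, and let $\gamma\mapsto a_\gamma>0$ be the monomorphism such that $\hat h$ induces $h_\gamma(x)=a_\gamma x$ on $\Gamma$. Let $M=\Gamma\backslash(\mathbb R\times\widetilde L)$ for the diagonal action $\gamma\cdot(x,\tilde y)=(a_\gamma x,\gamma\cdot\tilde y)$, with the foliation $\mathcal F$ whose leaves are the images of the sets $\{x\}\times\widetilde L$; identify $L$ with the compact leaf that is the image of $\{0\}\times\widetilde L$, through $\pi(\tilde y)\equiv[0,\tilde y]$. Let $\mathfrak X(\mathcal F)$ be the Lie algebra of smooth vector fields on $M$ tangent to the leaves. A smooth vector field on $M$ is called foliated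 if it belongs to the normalizer of $\mathfrak X(\mathcal F)$ in the Lie algebra of smooth vector fields. Given $\varkappa\in\mathbb R\smallsetminus\{0\}$, let $Y$ be the vector field on $M$ induced by the $\Gamma$-invariant vector field $(\varkappa x\,\partial_x,0)$ on $\mathbb R\times\widetilde L$. A complete smooth vector field $Z$ with flow $\phi$ is called simple if, for every zero $p$ of $Z$, the endomorphism $H_p$ of the tangent space at $p$ with $\phi^t_*=e^{tH_p}$ for all $t$ is an automorphism, and, for every point $p$ of every closed orbit $c$ of $\phi$ (zeros are not considered as closed orbits), with smallest positive period $\ell(c)$, the endomorphism induced by $\phi^{\ell(c)}_*$ on the quotient of the tangent space at $p$ by $\mathbb R\,Z(p)$ does not have the eigenvalue $1$. Then, for every simple smooth vector field $A$ on $L$ without closed orbits, there is a complete, foliated, simple smooth vector field $B$ on $M$ without closed orbits such that $B-Y\in\mathfrak X(\mathcal F)$ (that is, $B$ and $Y$ define the same transverse vector field, $\overline B=\overline Y\equiv\varkappa x\,\partial_x$) and the restriction of $B$ to $L$ is $A$. -/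

import Mathlib

open scoped Manifold ContDiff Topology

/-! ### Vector fields, flows, closed orbits -/

section VectorFields

variable {E : Type*} [NormedAddCommGroup E] [NormedSpace ℝ E]
  {H : Type*} [TopologicalSpace H] (I : ModelWithCorners ℝ E H)
  {M : Type*} [TopologicalSpace M] [ChartedSpace H M]

/-- The vector field `V` is smooth, as a section of the tangent bundle. -/
def IsSmoothField [IsManifold I ∞ M] (V : (p : M) → TangentSpace I p) : Prop :=
  ContMDiff I I.tangent ∞ (fun p : M => (⟨p, V p⟩ : TangentBundle I M))

/-- Every integral curve of `V` extends to the whole real line. -/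
def IsCompleteField (V : (p : M) → TangentSpace I p) : Prop :=
  ∀ p : M, ∃ c : ℝ → M, c 0 = p ∧ IsMIntegralCurve (I := I) c V

/-- `V` has no closed orbits: an integral curve that returns to its starting point after a
positive time is a fixed point. -/
def HasNoClosedOrbits (V : (p : M) → TangentSpace I p) : Prop :=
  ∀ c : ℝ → M, IsMIntegralCurve (I := I) c V → ∀ T : ℝ, 0 < T → c T = c 0 → V (c 0) = 0

/-- `φ` is the (global, smooth) flow with infinitesimal generator `V`. -/
structure IsFlowOf (V : (p : M) → TangentSpace I p) (φ : ℝ → M → M) : Prop where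
  contMDiff : ContMDiff (𝓘(ℝ, ℝ).prod I) I ∞ (fun z : ℝ × M => φ z.1 z.2)
  map_zero : ∀ p, φ 0 p = p
  map_add : ∀ s t p, φ (s + t) p = φ s (φ t p)
  isMIntegralCurve : ∀ p, IsMIntegralCurve (I := I) (fun t => φ t p) V

/-- The differential of `f` at a point `p`, as an endomorphism of the model vector space `E` of all
the tangent spaces. It is used where `f p = p`, and then it is the differential as an endomorphism
of the tangent space at `p`. -/
noncomputable def diffEnd (f : M → M) (p : M) : E →L[ℝ] E := mfderiv I I f p

/-- A fixed point `p` of the flow `φ` is simple if the endomorphism `A` of the tangent space at `p`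
with `φᵗ_* = exp (t A)` for all `t` is an automorphism. -/
def IsSimpleFixedPoint (φ : ℝ → M → M) (p : M) : Prop :=
  ∃ A : E →L[ℝ] E, (∀ t : ℝ, diffEnd I (φ t) p = NormedSpace.exp (t • A)) ∧ IsUnit A

/-- The line spanned by `V p`, the tangent line at `p` of the orbit through `p`. -/
def orbitLine (V : (p : M) → TangentSpace I p) (p : M) : Submodule ℝ E :=
  Submodule.span ℝ {(V p : E)}

/-- For a point `p` of a closed orbit of period `ℓ`, the endomorphism that `φ^ℓ_*` induces on the
normal space to the orbit at `p` does not have the eigenvalue `1`. -/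
def IsSimplePeriodicPoint (V : (p : M) → TangentSpace I p) (φ : ℝ → M → M) (ℓ : ℝ) (p : M) :
    Prop :=
  ∃ N : Module.End ℝ (E ⧸ orbitLine I V p),
    (∀ v : E, N ((orbitLine I V p).mkQ v) = (orbitLine I V p).mkQ (diffEnd I (φ ℓ) p v)) ∧
      ¬ N.HasEigenvalue 1

/-- A complete vector field is simple if all the fixed points and all the closed orbits of its flow
are simple. -/
def IsSimpleField (V : (p : M) → TangentSpace I p) : Prop :=
  ∃ φ : ℝ → M → M, IsFlowOf I V φ ∧
    (∀ p, V p = 0 → IsSimpleFixedPoint I φ p) ∧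
    (∀ p, V p ≠ 0 → ∀ ℓ : ℝ, IsLeast {t : ℝ | 0 < t ∧ φ t p = p} ℓ →
      IsSimplePeriodicPoint I V φ ℓ p)

end VectorFields

/-! ### The suspension of a representation by homotheties -/

/-- A homomorphism `hol` from the fundamental group of the `n`-manifold `L` to the group of
orientation preserving diffeomorphisms of `ℝ` fixing `0`, with values in the homotheties
`x ↦ a x`, `a > 0`, and the pointed smooth covering `proj : (Lt, baseLift) → (L, base)` for which
the fundamental group of `Lt` is the kernel of `hol`. -/
structure HomothetyRep (n : ℕ)
    (L : Type*) [TopologicalSpace L] [ChartedSpace (EuclideanSpace ℝ (Fin n)) L]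
    (Lt : Type*) [TopologicalSpace Lt] [ChartedSpace (EuclideanSpace ℝ (Fin n)) Lt] where
  base : L
  hol : FundamentalGroup L base →* Equiv.Perm ℝ
  hol_homothety : ∀ γ, ∃ a : ℝ, 0 < a ∧ ∀ x, hol γ x = a * x
  proj : Lt → L
  isCoveringMap : IsCoveringMap proj
  isLocalDiffeomorph : IsLocalDiffeomorph (𝓡 n) (𝓡 n) ∞ proj
  baseLift : Lt
  proj_baseLift : proj baseLift = base
  range_eq_ker :
    (FundamentalGroup.mapOfEq ⟨proj, isCoveringMap.continuous⟩ proj_baseLift).range = hol.ker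

section

open CategoryTheory

/-- The change of base points in the lifting criterion for a regular covering. -/
theorem range_map_le_of_normal {X Y : Type*} [TopologicalSpace X] [TopologicalSpace Y]
    [PathConnectedSpace X] (f : C(X, Y)) {x₀ : X} {y₀ : Y} (h : f x₀ = y₀)
    (hn : (FundamentalGroup.mapOfEq f h).range.Normal) {x x' : X} (h' : f x' = f x) :
    (FundamentalGroup.map f x).range ≤ (FundamentalGroup.mapOfEq f h').range := by
  subst h
  rintro _ ⟨d, rfl⟩
  let P : FundamentalGroupoid X ⥤ FundamentalGroupoid Y := FundamentalGroupoid.map f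
  let c : FundamentalGroupoid.mk x₀ ⟶ FundamentalGroupoid.mk x :=
    Path.Homotopic.Quotient.mk (PathConnectedSpace.somePath x₀ x)
  let c' : FundamentalGroupoid.mk x₀ ⟶ FundamentalGroupoid.mk x' :=
    Path.Homotopic.Quotient.mk (PathConnectedSpace.somePath x₀ x')
  let d' : FundamentalGroupoid.mk x ⟶ FundamentalGroupoid.mk x := d
  let e : P.obj (FundamentalGroupoid.mk x') ≅ P.obj (FundamentalGroupoid.mk x) :=
    eqToIso (congrArg FundamentalGroupoid.mk h')
  let g' : P.obj (FundamentalGroupoid.mk x₀) ⟶ P.obj (FundamentalGroupoid.mk x₀) := P.map c' ≫ e.hom ≫ inv (P.map c)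
  let g : FundamentalGroup Y (f x₀) := g'
  let a : FundamentalGroup X x₀ := c ≫ d' ≫ inv c
  obtain ⟨ε, hε⟩ := hn.conj_mem (FundamentalGroup.mapOfEq f rfl a) ⟨a, rfl⟩ g⁻¹
  let ε' : FundamentalGroupoid.mk x₀ ⟶ FundamentalGroupoid.mk x₀ := ε
  have h1 : FundamentalGroup.mapOfEq f rfl a = P.map (c ≫ d' ≫ inv c) := by
    rw [FundamentalGroup.mapOfEq_apply]
    exact Path.Homotopic.Quotient.cast_rfl_rfl _
  have h2 : FundamentalGroup.mapOfEq f rfl ε = P.map ε' := by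
    rw [FundamentalGroup.mapOfEq_apply]
    exact Path.Homotopic.Quotient.cast_rfl_rfl _
  have h3 : P.map ε' = P.map c' ≫ e.hom ≫ P.map d' ≫ e.inv ≫ inv (P.map c') := by
    rw [← h2, hε, h1, inv_inv]
    have : g⁻¹ = P.map c ≫ e.inv ≫ inv (P.map c') := by
      change Groupoid.inv (P.map c' ≫ e.hom ≫ inv (P.map c)) = _
      rw [Groupoid.inv_eq_inv]
      simp
    rw [this]
    change (P.map c' ≫ e.hom ≫ inv (P.map c)) ≫ P.map (c ≫ d' ≫ inv c) ≫
      P.map c ≫ e.inv ≫ inv (P.map c') = _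
    simp
  refine ⟨(inv c' ≫ ε' ≫ c' : FundamentalGroupoid.mk x' ⟶ FundamentalGroupoid.mk x'), ?_⟩
  change e.inv ≫ P.map (inv c' ≫ ε' ≫ c') ≫ e.hom = P.map d'
  rw [P.map_comp, P.map_comp, h3]
  simp

end

namespace HomothetyRep

variable {n : ℕ}
  {L : Type*} [TopologicalSpace L] [ChartedSpace (EuclideanSpace ℝ (Fin n)) L]
  {Lt : Type*} [TopologicalSpace Lt] [ChartedSpace (EuclideanSpace ℝ (Fin n)) Lt]
  (S : HomothetyRep n L Lt)

/-- The group `Γ` of deck transformations of the covering; it is the quotient of the fundamental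
group of `L` by the kernel of `hol`. -/
def Γ : Subgroup (Lt ≃ₜ Lt) where
  carrier := {T | ∀ y, S.proj (T y) = S.proj y}
  mul_mem' {T T'} h h' y := (h (T' y)).trans (h' y)
  one_mem' _ := rfl
  inv_mem' {T} h y := by
    have := h (T⁻¹ y)
    rw [← this]
    exact congrArg S.proj (T.apply_symm_apply y)

/-- The class in the fundamental group of `L` of the projection of a path from `baseLift` to
`T baseLift`. -/
def loopOf (T : S.Γ) (c : Path S.baseLift (T.1 S.baseLift)) : FundamentalGroup L S.base :=
  FundamentalGroup.fromPath (Path.Homotopic.Quotient.mk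
    ((c.map S.isCoveringMap.continuous).cast S.proj_baseLift.symm
      (S.proj_baseLift.symm.trans (T.2 _).symm)))

theorem hol_loopOf_eq (T : S.Γ) (c c' : Path S.baseLift (T.1 S.baseLift)) :
    S.hol (S.loopOf T c) = S.hol (S.loopOf T c') := by
  have hmem : (S.loopOf T c')⁻¹ * S.loopOf T c ∈ S.hol.ker := by
    rw [← S.range_eq_ker]
    refine ⟨FundamentalGroup.fromPath (Path.Homotopic.Quotient.mk (c.trans c'.symm)), ?_⟩
    rw [FundamentalGroup.mapOfEq_apply]
    refine congrArg Path.Homotopic.Quotient.mk ?_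
    ext t
    simp [Path.trans_apply, Path.map_trans]
  rw [MonoidHom.mem_ker, map_mul, map_inv, inv_mul_eq_one] at hmem
  exact hmem.symm

theorem pathConnectedSpace [ConnectedSpace Lt] (_ : HomothetyRep n L Lt) :
    PathConnectedSpace Lt := by
  have : LocallyPathConnectedSpace Lt :=
    ChartedSpace.locallyPathConnectedSpace (EuclideanSpace ℝ (Fin n)) Lt
  exact pathConnectedSpace_iff_connectedSpace.2 inferInstance

/-- The homothety `x ↦ a x` of the real line assigned by `hol` to a deck transformation `T`. Here
`T` corresponds to the class of the loops in `L` whose lift from `baseLift` ends at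
`T baseLift`. -/
noncomputable def h [ConnectedSpace Lt] (T : S.Γ) : Equiv.Perm ℝ :=
  S.hol (S.loopOf T (S.pathConnectedSpace.somePath S.baseLift (T.1 S.baseLift)))

theorem h_eq [ConnectedSpace Lt] (T : S.Γ) (c : Path S.baseLift (T.1 S.baseLift)) :
    S.h T = S.hol (S.loopOf T c) :=
  S.hol_loopOf_eq T _ c

theorem h_homothety [ConnectedSpace Lt] (T : S.Γ) : ∃ a : ℝ, 0 < a ∧ ∀ x, S.h T x = a * x :=
  S.hol_homothety _

theorem h_one [ConnectedSpace Lt] : S.h 1 = 1 := by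
  rw [S.h_eq 1 (Path.refl _)]
  refine Eq.trans (congrArg S.hol ?_) (map_one S.hol)
  refine congrArg Path.Homotopic.Quotient.mk ?_
  ext t
  exact S.proj_baseLift

theorem h_mul [ConnectedSpace Lt] (T T' : S.Γ) : S.h (T * T') = S.h T * S.h T' := by
  have := S.pathConnectedSpace
  let c := PathConnectedSpace.somePath S.baseLift (T.1 S.baseLift)
  let c' := PathConnectedSpace.somePath S.baseLift (T'.1 S.baseLift)
  let d : Path S.baseLift ((T * T').1 S.baseLift) := c.trans (c'.map T.1.continuous)
  have hd : S.loopOf (T * T') d = S.loopOf T' c' * S.loopOf T c := by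
    refine congrArg Path.Homotopic.Quotient.mk ?_
    ext t
    change S.proj ((c.trans (c'.map T.1.continuous)) t) = _
    rw [Path.trans_apply, Path.trans_apply]
    split_ifs with ht
    · rfl
    · exact T.2 _
  rw [S.h_eq _ d, hd, map_mul, S.h_eq T c, S.h_eq T' c']
  obtain ⟨a, -, ha⟩ := S.hol_homothety (S.loopOf T c)
  obtain ⟨b, -, hb⟩ := S.hol_homothety (S.loopOf T' c')
  ext x
  simp [ha, hb]
  ring

/-- The diagonal action `T • (x, y) = (h T x, T y)` of `Γ` on `ℝ × Lt`. -/
noncomputable instance diagonalAction [ConnectedSpace Lt] : MulAction S.Γ (ℝ × Lt) where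
  smul T z := (S.h T z.1, T.1 z.2)
  one_smul z := by
    change (S.h 1 z.1, (1 : Lt ≃ₜ Lt) z.2) = z
    rw [h_one]
    rfl
  mul_smul T T' z := by
    change (S.h (T * T') z.1, (T.1 * T'.1) z.2) = (S.h T (S.h T' z.1), T.1 (T'.1 z.2))
    rw [h_mul]
    rfl

theorem smul_def [ConnectedSpace Lt] (T : S.Γ) (z : ℝ × Lt) :
    T • z = (S.h T z.1, T.1 z.2) := rfl

/-- The suspension manifold `Γ \ (ℝ × Lt)`. -/
def M [ConnectedSpace Lt] : Type _ := MulAction.orbitRel.Quotient S.Γ (ℝ × Lt)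

instance [ConnectedSpace Lt] : TopologicalSpace S.M :=
  inferInstanceAs (TopologicalSpace (MulAction.orbitRel.Quotient S.Γ (ℝ × Lt)))

/-- The canonical projection `(x, y) ↦ [x, y]` of `ℝ × Lt` to the suspension. -/
noncomputable def projM [ConnectedSpace Lt] (z : ℝ × Lt) : S.M :=
  Quotient.mk (MulAction.orbitRel S.Γ (ℝ × Lt)) z

theorem projM_surjective [ConnectedSpace Lt] : Function.Surjective S.projM := Quotient.mk_surjective

theorem projM_eq_iff [ConnectedSpace Lt] {z w : ℝ × Lt} :
    S.projM z = S.projM w ↔ ∃ T : S.Γ, T • w = z := Quotient.eq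

theorem contMDiff_deck (T : S.Γ) : ContMDiff (𝓡 n) (𝓡 n) ∞ T.1 := by
  intro y
  obtain ⟨Φ, hΦ, hEq⟩ := S.isLocalDiffeomorph (T.1 y)
  have h1 : ContMDiffAt (𝓡 n) (𝓡 n) ∞ Φ.symm (S.proj y) := by
    refine Φ.symm.contMDiffOn.contMDiffAt (Φ.open_target.mem_nhds ?_)
    rw [← T.2 y, hEq hΦ]
    exact Φ.map_source hΦ
  have h2 : ContMDiffAt (𝓡 n) (𝓡 n) ∞ (Φ.symm ∘ S.proj) y :=
    h1.comp y (S.isLocalDiffeomorph.contMDiff y)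
  refine h2.congr_of_eventuallyEq ?_
  filter_upwards [T.1.continuous.continuousAt.preimage_mem_nhds (Φ.open_source.mem_nhds hΦ)]
    with u hu
  have := hEq hu
  change T.1 u = Φ.symm (S.proj u)
  rw [← T.2 u, this]
  exact (Φ.left_inv hu).symm

theorem contMDiff_smul [ConnectedSpace Lt] (T : S.Γ) :
    ContMDiff (𝓘(ℝ, ℝ).prod (𝓡 n)) (𝓘(ℝ, ℝ).prod (𝓡 n)) ∞ (fun z : ℝ × Lt => T • z) := by
  obtain ⟨a, -, ha⟩ := S.h_homothety T
  have : (fun z : ℝ × Lt => T • z) = Prod.map (fun x => a * x) T.1 := by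
    ext z
    · simp [smul_def, ha]
    · rfl
  rw [this]
  exact (contDiff_const.mul contDiff_id).contMDiff.prodMap (S.contMDiff_deck T)

theorem isQuotientCoveringMap_projM [ConnectedSpace Lt] : IsQuotientCoveringMap S.projM S.Γ where
  toIsQuotientMap := isQuotientMap_quotient_mk'
  continuous_const_smul T := (S.contMDiff_smul T).continuous
  apply_eq_iff_mem_orbit := S.projM_eq_iff
  disjoint := by
    rintro ⟨x, y⟩
    obtain ⟨e, hy, he⟩ := S.isCoveringMap.isLocalHomeomorph y
    refine ⟨Set.univ ×ˢ e.source, prod_mem_nhds Filter.univ_mem (e.open_source.mem_nhds hy), ?_⟩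
    rintro T ⟨_, ⟨⟨x', y'⟩, ⟨-, h1⟩, rfl⟩, -, h2⟩
    have h3 : T.1 y' = y' := e.injOn h2 h1 (by rw [← he]; exact T.2 y')
    refine Subtype.ext (Homeomorph.ext fun u => ?_)
    exact congrFun (S.isCoveringMap.eq_of_comp_eq T.1.continuous continuous_id
      (funext fun u => T.2 u) y' h3) u

theorem isLocalHomeomorph_projM [ConnectedSpace Lt] : IsLocalHomeomorph S.projM :=
  S.isQuotientCoveringMap_projM.isCoveringMap.isLocalHomeomorph

/-- The charts of the suspension are those of `ℝ × Lt`, composed with local inverses of the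
projection. -/
noncomputable instance [ConnectedSpace Lt] :
    ChartedSpace (ModelProd ℝ (EuclideanSpace ℝ (Fin n))) S.M :=
  S.isLocalHomeomorph_projM.chartedSpace S.projM_surjective

/-- A local inverse of the projection, precomposed with the projection, is locally a deck
transformation. -/
theorem exists_eventually_localInverse [ConnectedSpace Lt] (v z : ℝ × Lt)
    (hz : S.projM z ∈ (S.isLocalHomeomorph_projM.localInverseAt v).source) :
    ∃ T : S.Γ, ∀ᶠ u in 𝓝 z, S.isLocalHomeomorph_projM.localInverseAt v (S.projM u) = T • u := by
  set s := S.isLocalHomeomorph_projM.localInverseAt v with hs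
  have hsymm : ⇑s.symm = S.projM := S.isLocalHomeomorph_projM.localInverseAt_symm v
  have h1 : S.projM (s (S.projM z)) = S.projM z := by
    rw [← hsymm]
    exact s.left_inv (by rwa [hsymm])
  obtain ⟨T, hT⟩ := S.projM_eq_iff.1 h1
  refine ⟨T, ?_⟩
  have hc : ContinuousAt (fun u : ℝ × Lt => T • u) z := (S.contMDiff_smul T).continuous.continuousAt
  have hcm : ContinuousAt S.projM z := S.isLocalHomeomorph_projM.continuous.continuousAt
  have ht : T • z ∈ s.target := by
    rw [hT]
    exact s.map_source hz
  filter_upwards [hc.preimage_mem_nhds (s.open_target.mem_nhds ht),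
    hcm.preimage_mem_nhds (s.open_source.mem_nhds hz)] with u hu hu'
  have h2 : S.projM (T • u) = S.projM u := S.projM_eq_iff.2 ⟨T, rfl⟩
  rw [← h2, ← hsymm]
  exact s.right_inv hu

/-- The model with corners of the suspension. -/
noncomputable abbrev model (n : ℕ) : ModelWithCorners ℝ (ℝ × EuclideanSpace ℝ (Fin n))
    (ModelProd ℝ (EuclideanSpace ℝ (Fin n))) := 𝓘(ℝ, ℝ).prod (𝓡 n)

instance isManifold [ConnectedSpace Lt] [IsManifold (𝓡 n) ∞ Lt] :
    IsManifold (model n) ∞ S.M := by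
  refine isManifold_of_contDiffOn _ _ _ ?_
  rintro _ _ ⟨q, rfl⟩ ⟨q', rfl⟩
  set v := S.projM_surjective.hasRightInverse.choose q
  set v' := S.projM_surjective.hasRightInverse.choose q'
  rintro w ⟨hw, hwr⟩
  have hsymm := S.isLocalHomeomorph_projM.localInverseAt_symm v
  set s := S.isLocalHomeomorph_projM.localInverseAt v
  set s' := S.isLocalHomeomorph_projM.localInverseAt v' with hs'
  set c := chartAt (ModelProd ℝ (EuclideanSpace ℝ (Fin n))) v with hcdef
  set c' := chartAt (ModelProd ℝ (EuclideanSpace ℝ (Fin n))) v' with hcdef'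
  simp only [OpenPartialHomeomorph.trans_symm_eq_symm_trans_symm, Set.mem_preimage,
    OpenPartialHomeomorph.trans_source, OpenPartialHomeomorph.symm_source, Set.mem_inter_iff,
    OpenPartialHomeomorph.coe_trans, Function.comp_apply, hsymm] at hw
  obtain ⟨⟨hw1, hw2⟩, hw3, hw4⟩ := hw
  set z := c.symm ((model n).symm w) with hz
  obtain ⟨T, hT⟩ := S.exists_eventually_localInverse v' z hw3
  have hzc : z ∈ c.source := c.map_target hw1
  have hTz : T • z ∈ c'.source := by rw [← hT.self_of_nhds]; exact hw4
  have key := ((contMDiffAt_iff_of_mem_source (I := model n) (I' := model n) (n := ∞)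
    (f := fun u : ℝ × Lt => T • u) (x := v) (y := v') hzc hTz).1 (S.contMDiff_smul T z)).2
  have hwz : extChartAt (model n) v z = w := by
    simp only [extChartAt, OpenPartialHomeomorph.extend_coe, Function.comp_apply]
    rw [hz, ← hcdef, c.right_inv hw1, (model n).right_inv hwr]
  rw [hwz] at key
  have hcont : ContinuousAt (fun u => c.symm ((model n).symm u)) w :=
    ContinuousAt.comp (c.continuousAt_symm hw1) (model n).continuous_symm.continuousAt
  have hev := hcont.eventually hT
  refine (key.congr_of_eventuallyEq ?_ ?_).mono Set.inter_subset_right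
  · filter_upwards [mem_nhdsWithin_of_mem_nhds hev] with u hu
    change model n (c' (s' (s.symm (c.symm ((model n).symm u))))) = _
    rw [hsymm, hu]
    rfl
  · change model n (c' (s' (s.symm (c.symm ((model n).symm w))))) = _
    rw [hsymm, hev.self_of_nhds]
    rfl

theorem contMDiff_projM [ConnectedSpace Lt] [IsManifold (𝓡 n) ∞ Lt] :
    ContMDiff (model n) (model n) ∞ S.projM := by
  intro z
  have hg := S.projM_surjective.hasRightInverse.choose_spec
  set v := S.projM_surjective.hasRightInverse.choose (S.projM z) with hv
  have hpv : S.projM v = S.projM z := hg _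
  have hself := S.isLocalHomeomorph_projM.localInverseAt_apply_self (x := v)
  have hsrc : S.projM z ∈ (S.isLocalHomeomorph_projM.localInverseAt v).source := by
    rw [← hpv]
    exact S.isLocalHomeomorph_projM.apply_self_mem_localInverseAt_source
  obtain ⟨T, hT⟩ := S.exists_eventually_localInverse v z hsrc
  have hTz : T • z = v := by rw [← hT.self_of_nhds, ← hpv, hself]
  have key := ((contMDiffAt_iff_of_mem_source (I := model n) (I' := model n) (n := ∞)
    (f := fun u : ℝ × Lt => T • u) (x := z) (y := v) (mem_chart_source _ z)
    (by rw [hTz]; exact mem_chart_source _ v)).1 (S.contMDiff_smul T z)).2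
  refine contMDiffAt_iff.2 ⟨S.isLocalHomeomorph_projM.continuous.continuousAt, ?_⟩
  have hev : ∀ᶠ u in 𝓝 (extChartAt (model n) z z),
      S.isLocalHomeomorph_projM.localInverseAt v (S.projM ((extChartAt (model n) z).symm u)) =
        T • (extChartAt (model n) z).symm u := by
    have h0 := (continuousAt_extChartAt_symm (I := model n) z).tendsto
    rw [extChartAt_to_inv] at h0
    exact h0.eventually hT
  refine key.congr_of_eventuallyEq ?_ ?_
  · filter_upwards [mem_nhdsWithin_of_mem_nhds hev] with u hu
    exact congrArg (extChartAt (model n) v) hu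
  · exact congrArg (extChartAt (model n) v) hev.self_of_nhds

/-- The covering is regular: `Γ` acts transitively on the fibers. -/
theorem exists_deck [ConnectedSpace Lt] {y y' : Lt} (hy : S.proj y' = S.proj y) :
    ∃ T : S.Γ, T.1 y = y' := by
  have lift : ∀ y y' : Lt, S.proj y' = S.proj y →
      ∃ F : C(Lt, Lt), F y = y' ∧ S.proj ∘ F = S.proj := by
    intro y y' hy
    have := S.pathConnectedSpace
    have : LocallyPathConnectedSpace Lt :=
      ChartedSpace.locallyPathConnectedSpace (EuclideanSpace ℝ (Fin n)) Lt
    refine (S.isCoveringMap.existsUnique_continuousMap_lifts_of_range_le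
      (f := ⟨S.proj, S.isCoveringMap.continuous⟩) (a₀ := y) (e₀ := y') hy ?_).exists
    refine range_map_le_of_normal _ S.proj_baseLift ?_ hy
    rw [S.range_eq_ker]
    infer_instance
  obtain ⟨F, hF, hF'⟩ := lift y y' hy
  obtain ⟨G, hG, hG'⟩ := lift y' y hy.symm
  have h1 : ⇑G ∘ ⇑F = id := S.isCoveringMap.eq_of_comp_eq (G.continuous.comp F.continuous)
    continuous_id (by rw [← Function.comp_assoc, hG', hF']; rfl) y (by simp [hF, hG])
  have h2 : ⇑F ∘ ⇑G = id := S.isCoveringMap.eq_of_comp_eq (F.continuous.comp G.continuous)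
    continuous_id (by rw [← Function.comp_assoc, hF', hG']; rfl) y' (by simp [hF, hG])
  exact ⟨⟨⟨⟨F, G, congrFun h1, congrFun h2⟩, F.continuous, G.continuous⟩, congrFun hF'⟩, hF⟩

theorem proj_surjective [ConnectedSpace L] : Function.Surjective S.proj := by
  have : LocallyPathConnectedSpace L :=
    ChartedSpace.locallyPathConnectedSpace (EuclideanSpace ℝ (Fin n)) L
  have : PathConnectedSpace L := pathConnectedSpace_iff_connectedSpace.2 inferInstance
  intro y
  let c := PathConnectedSpace.somePath S.base y
  exact ⟨_, (S.isCoveringMap.monodromy (Path.Homotopic.Quotient.mk c)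
    ⟨S.baseLift, S.proj_baseLift⟩).2⟩

/-- The identification of `L` with the compact leaf `[{0} × Lt]`, sending the projection of `y` to
`[0, y]`. -/
noncomputable def zeroSection [ConnectedSpace L] [ConnectedSpace Lt] (y : L) : S.M :=
  S.projM (0, (S.proj_surjective y).choose)

theorem zeroSection_proj [ConnectedSpace L] [ConnectedSpace Lt] (y : Lt) :
    S.zeroSection (S.proj y) = S.projM (0, y) := by
  obtain ⟨T, hT⟩ := S.exists_deck (S.proj_surjective (S.proj y)).choose_spec
  obtain ⟨a, -, ha⟩ := S.h_homothety T
  exact S.projM_eq_iff.2 ⟨T, by rw [smul_def, ha, hT]; simp⟩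

/-- The tangent space at `[x, y]` to the leaf `[{x} × Lt]` of the suspension foliation. -/
noncomputable def leafTangent [ConnectedSpace Lt] (z : ℝ × Lt) :
    Submodule ℝ (TangentSpace (model n) (S.projM z)) :=
  Submodule.map (mfderiv (model n) (model n) S.projM z).toLinearMap
    (Submodule.prod ⊥ ⊤ : Submodule ℝ (ℝ × EuclideanSpace ℝ (Fin n)))

/-- The smooth vector fields tangent to the leaves. -/
def IsLeafwise [ConnectedSpace Lt] [IsManifold (𝓡 n) ∞ Lt]
    (V : (q : S.M) → TangentSpace (model n) q) : Prop :=
  IsSmoothField (model n) V ∧ ∀ z, V (S.projM z) ∈ S.leafTangent z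

/-- The infinitesimal transformations of the suspension foliation: the smooth vector fields that
normalize the Lie algebra of leafwise vector fields. -/
def IsFoliated [ConnectedSpace Lt] [IsManifold (𝓡 n) ∞ Lt]
    (V : (q : S.M) → TangentSpace (model n) q) : Prop :=
  IsSmoothField (model n) V ∧
    ∀ W, S.IsLeafwise W → S.IsLeafwise (VectorField.mlieBracket (model n) V W)

/-- The vector field on the suspension induced by the invariant vector field `(κ x ∂ₓ, 0)` on
`ℝ × Lt`. -/
noncomputable def Y [ConnectedSpace Lt] (κ : ℝ) (q : S.M) : TangentSpace (model n) q :=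
  (S.projM_surjective q).choose_spec ▸
    mfderiv (model n) (model n) S.projM (S.projM_surjective q).choose
      ((κ * (S.projM_surjective q).choose.1, 0) : ℝ × EuclideanSpace ℝ (Fin n))

theorem Y_projM [ConnectedSpace Lt] [IsManifold (𝓡 n) ∞ Lt] (κ : ℝ) (z : ℝ × Lt) :
    S.Y κ (S.projM z) = mfderiv (model n) (model n) S.projM z
      ((κ * z.1, 0) : ℝ × EuclideanSpace ℝ (Fin n)) := by
  have key : ∀ (w : ℝ × Lt) (hw : S.projM w = S.projM z),
      (hw ▸ mfderiv (model n) (model n) S.projM w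
        ((κ * w.1, 0) : ℝ × EuclideanSpace ℝ (Fin n)) : TangentSpace (model n) (S.projM z)) =
      mfderiv (model n) (model n) S.projM z ((κ * z.1, 0) : ℝ × EuclideanSpace ℝ (Fin n)) := by
    intro w hw
    have cast : ∀ {q q' : S.M} (hq : q = q') (v : TangentSpace (model n) q),
        (hq ▸ v : TangentSpace (model n) q') = (show ℝ × EuclideanSpace ℝ (Fin n) from v) := by
      rintro q _ rfl v
      rfl
    rw [cast]
    obtain ⟨T, rfl⟩ := S.projM_eq_iff.1 hw
    obtain ⟨a, -, ha⟩ := S.h_homothety T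
    have hT : (fun u : ℝ × Lt => T • u) = Prod.map (fun x => a * x) T.1 := by
      ext u
      · simp [smul_def, ha]
      · rfl
    have d1 : HasMFDerivAt 𝓘(ℝ, ℝ) 𝓘(ℝ, ℝ) (fun x : ℝ => a * x) z.1
        (a • ContinuousLinearMap.id ℝ ℝ) :=
      ((hasFDerivAt_id z.1).const_smul a).hasMFDerivAt
    have d2 := ((S.contMDiff_deck T).mdifferentiableAt (x := z.2) (by simp)).hasMFDerivAt
    have d3 := HasMFDerivAt.prodMap (p := z) (d1.mdifferentiableAt.hasMFDerivAt) d2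
    rw [← hT, d1.mfderiv] at d3
    have d4 := ((S.contMDiff_projM).mdifferentiableAt (x := T • z) (by simp)).hasMFDerivAt
    have d5 := d4.comp z d3
    have d6 : S.projM ∘ (fun u : ℝ × Lt => T • u) = S.projM :=
      funext fun u => S.projM_eq_iff.2 ⟨T, rfl⟩
    rw [d6] at d5
    rw [d5.mfderiv]
    change _ = mfderiv (model n) (model n) S.projM (T • z)
      ((a * (κ * z.1), mfderiv (𝓡 n) (𝓡 n) T.1 z.2 0) : ℝ × EuclideanSpace ℝ (Fin n))
    rw [map_zero, smul_def, ha, mul_left_comm]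
    rfl
  exact key _ _

end HomothetyRep

/-! ### Local diffeomorphisms -/

section LocalDiffeomorph

variable {E : Type*} [NormedAddCommGroup E] [NormedSpace ℝ E]
  {H : Type*} [TopologicalSpace H] {I : ModelWithCorners ℝ E H}
  {X : Type*} [TopologicalSpace X] [ChartedSpace H X]
  {E' : Type*} [NormedAddCommGroup E'] [NormedSpace ℝ E']
  {H' : Type*} [TopologicalSpace H'] {I' : ModelWithCorners ℝ E' H'}
  {Y : Type*} [TopologicalSpace Y] [ChartedSpace H' Y]
  {F : Type*} [NormedAddCommGroup F] [NormedSpace ℝ F]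
  {G : Type*} [TopologicalSpace G] {J : ModelWithCorners ℝ F G}
  {N : Type*} [TopologicalSpace N] [ChartedSpace G N]
  {k : ℕ∞ω} {p : X → Y} {f : N → X} {x : N}

/-! The field `B` is the generator of an explicit flow. Let `φ` be the flow of `A`. It lifts through
the covering to a flow `ψ` on `Lt` that commutes with the deck transformations. Homotheties of the
line commute with each other, so the product flow `(x, y) ↦ (e^{κt} x, ψ t y)` commutes with the
diagonal action of `Γ` and descends to `M`. Its generator lifts to `(κ x, Ã)`, where `Ã` is the lift
of `A`.

Most of the conclusions are read off this lift. `B` is complete because its flow is global. `B - Y`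
lifts to `(0, Ã)`, so it is leafwise. The transverse component `κ x` depends on `x` alone, so a
bracket with a leafwise field has no transverse component (`fst_lieBracket_eq_zero`), and `B` is
foliated. The zero section intertwines `φ` with the new flow because `0` is fixed by homotheties;
hence `B` restricts to `A`.

For the dynamics, a zero of `B` is `[0, y]` with `y` over a zero of `A`, where the linearization is
`κ ⊕ H` with both summands invertible. If an orbit of `B` closes up, its lift returns up to a deck
transformation `T`, so its projection to `L` closes up and must be a fixed point of `φ`. Then the
`Lt` component is constant, `T` fixes a point and is trivial, and `e^{κτ} x = x` forces `x = 0`: the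
orbit is a zero (`hasNoClosedOrbits_suspFlow`). The simplicity condition on closed orbits is
therefore vacuous. Uniqueness of integral curves is needed only on `L`; on `M` one argues through
the covering. -/

theorem IsLocalDiffeomorphAt.eventuallyEq_localInverse_comp
    (hp : IsLocalDiffeomorphAt I I' k p (f x))
    (hf : ContinuousAt f x) : f =ᶠ[𝓝 x] hp.localInverse ∘ (p ∘ f) := by
  filter_upwards [hf.eventually hp.localInverse_eventuallyEq_left] with u hu
  exact hu.symm

/-- A continuous lift of a `C^k` map through a local diffeomorphism is `C^k`. -/
theorem IsLocalDiffeomorphAt.contMDiffAt_of_comp (hp : IsLocalDiffeomorphAt I I' k p (f x))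
    (hf : ContinuousAt f x) (hpf : ContMDiffAt J I' k (p ∘ f) x) : ContMDiffAt J I k f x :=
  (ContMDiffAt.comp x hp.localInverse_contMDiffAt hpf).congr_of_eventuallyEq
    (hp.eventuallyEq_localInverse_comp hf)

/-- A continuous lift of a differentiable map through a local diffeomorphism is differentiable. -/
theorem IsLocalDiffeomorphAt.mdifferentiableAt_of_comp
    (hp : IsLocalDiffeomorphAt I I' k p (f x)) (hk : k ≠ 0)
    (hf : ContinuousAt f x) (hpf : MDifferentiableAt J I' (p ∘ f) x) :
    MDifferentiableAt J I f x :=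
  (MDifferentiableAt.comp x (hp.localInverse_mdifferentiableAt hk) hpf).congr_of_eventuallyEq
    (hp.eventuallyEq_localInverse_comp hf)

/-- If `f ∘ p` is `C^k` for a local diffeomorphism `p`, then so is `f`. -/
theorem IsLocalDiffeomorphAt.contMDiffAt_of_comp_right {f : Y → N} {x : X}
    (hp : IsLocalDiffeomorphAt I I' k p x) (hfp : ContMDiffAt I J k (f ∘ p) x) :
    ContMDiffAt I' J k f (p x) := by
  have hx : hp.localInverse (p x) = x := hp.localInverse_left_inv hp.localInverse_mem_target
  have h := ContMDiffAt.comp (p x) (g := f ∘ p) (by rwa [hx]) hp.localInverse_contMDiffAt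
  refine h.congr_of_eventuallyEq ?_
  filter_upwards [hp.localInverse_eventuallyEq_right] with u hu
  exact congrArg f hu.symm

theorem IsLocalDiffeomorphAt.mfderiv_injective {x : X} (hp : IsLocalDiffeomorphAt I I' k p x)
    (hk : k ≠ 0) : Function.Injective (mfderiv I I' p x) :=
  (hp.mfderivToContinuousLinearEquiv hk).injective

end LocalDiffeomorph

/-! ### Smooth flows and their generators -/

section Flows

variable {E : Type*} [NormedAddCommGroup E] [NormedSpace ℝ E]
  {H : Type*} [TopologicalSpace H] (I : ModelWithCorners ℝ E H)
  {M : Type*} [TopologicalSpace M] [ChartedSpace H M]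

/-- Integral curves record their velocity as a linear map on `ℝ`; this recovers the vector. The
model space `E` stands for all the tangent spaces, to which the statement applies by unfolding. -/
theorem one_smulRight_apply_one (v : E) : ((1 : ℝ →L[ℝ] ℝ).smulRight v) 1 = v := by
  simp

/-- `φ` is a smooth action of the additive group of real numbers. -/
structure IsSmoothFlow (φ : ℝ → M → M) : Prop where
  contMDiff : ContMDiff (𝓘(ℝ, ℝ).prod I) I ∞ (fun z : ℝ × M => φ z.1 z.2)
  map_zero : ∀ p, φ 0 p = p
  map_add : ∀ s t p, φ (s + t) p = φ s (φ t p)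

/-- The velocity at time `0` of the orbits of `φ`. -/
noncomputable def flowGenerator (φ : ℝ → M → M) (p : M) : TangentSpace I p :=
  (mfderiv 𝓘(ℝ, ℝ) I (fun t => φ t p) 0 (1 : ℝ) : TangentSpace I (φ 0 p))

variable {I} {V : (p : M) → TangentSpace I p} {φ : ℝ → M → M}

theorem IsFlowOf.isSmoothFlow (h : IsFlowOf I V φ) : IsSmoothFlow I φ :=
  ⟨h.contMDiff, h.map_zero, h.map_add⟩

namespace IsSmoothFlow

theorem contMDiff_orbit (h : IsSmoothFlow I φ) (p : M) :
    ContMDiff 𝓘(ℝ, ℝ) I ∞ (fun t => φ t p) :=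
  h.contMDiff.comp (contMDiff_id.prodMk contMDiff_const)

theorem contMDiff_time (h : IsSmoothFlow I φ) (t : ℝ) : ContMDiff I I ∞ (φ t) :=
  h.contMDiff.comp (contMDiff_const.prodMk contMDiff_id)

theorem hasMFDerivAt_zero (h : IsSmoothFlow I φ) (p : M) :
    HasMFDerivAt 𝓘(ℝ, ℝ) I (fun t => φ t p) 0
      ((1 : ℝ →L[ℝ] ℝ).smulRight (flowGenerator I φ p : E)) := by
  have h1 := ((h.contMDiff_orbit p).mdifferentiableAt (x := 0) (by simp)).hasMFDerivAt
  have h2 : (1 : ℝ →L[ℝ] ℝ).smulRight (flowGenerator I φ p : E) =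
      (mfderiv 𝓘(ℝ, ℝ) I (fun t => φ t p) 0 : ℝ →L[ℝ] E) :=
    ContinuousLinearMap.ext_ring (one_smulRight_apply_one (E := E) (flowGenerator I φ p))
  exact h2 ▸ h1

/-- By the group law, the orbit of `p` near time `t` is the orbit of `φ t p` near time `0`, so the
velocity at time `0` determines all the others. -/
theorem isFlowOf (h : IsSmoothFlow I φ) : IsFlowOf I (flowGenerator I φ) φ where
  contMDiff := h.contMDiff
  map_zero := h.map_zero
  map_add := h.map_add
  isMIntegralCurve p t := by
    have h1 := h.hasMFDerivAt_zero (φ t p)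
    have h2 : HasMFDerivAt 𝓘(ℝ, ℝ) 𝓘(ℝ, ℝ) (fun s : ℝ => s - t) t (ContinuousLinearMap.id ℝ ℝ) :=
      ((hasFDerivAt_id t).sub_const t).hasMFDerivAt
    have h3 : HasMFDerivAt 𝓘(ℝ, ℝ) I (fun s => φ s (φ t p)) (t - t)
      ((1 : ℝ →L[ℝ] ℝ).smulRight (flowGenerator I φ (φ t p) : E)) := by
      rw [sub_self]
      exact h1
    have h4 := HasMFDerivAt.comp (f := fun s : ℝ => s - t) t h3 h2
    have h5 : (fun s => φ s (φ t p)) ∘ (fun s : ℝ => s - t) = fun s => φ s p := by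
      funext s
      simp only [Function.comp_apply]
      rw [← h.map_add, sub_add_cancel]
    rw [h5] at h4
    exact h4

/-- The generator is the tangent map of the action `ℝ × M → M` applied to the smooth section `(∂ₜ,
0)` along `{0} × M`. -/
theorem isSmoothField [IsManifold I ∞ M] (h : IsSmoothFlow I φ) :
    IsSmoothField I (flowGenerator I φ) := by
  have : IsManifold I 1 M := IsManifold.of_le (n := ∞) (by simp)
  have h1 := h.contMDiff.contMDiff_tangentMap (m := ∞) (by simp)
  have h2 : ContMDiff I (𝓘(ℝ, ℝ).tangent.prod I.tangent) ∞
      (fun p : M => ((⟨0, 1⟩, ⟨p, 0⟩) : TangentBundle 𝓘(ℝ, ℝ) ℝ × TangentBundle I M)) :=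
    contMDiff_const.prodMk (Bundle.contMDiff_zeroSection ℝ (TangentSpace I))
  have h3 := h1.comp ((contMDiff_equivTangentBundleProd_symm (n := ∞)).comp h2)
  refine h3.congr fun p => ?_
  have hd : HasMFDerivAt 𝓘(ℝ, ℝ) (𝓘(ℝ, ℝ).prod I) (fun t : ℝ => (t, p)) 0 _ :=
    HasMFDerivAt.prodMk (hasMFDerivAt_id (0 : ℝ)) (hasMFDerivAt_const p (0 : ℝ))
  have hc := HasMFDerivAt.comp (0 : ℝ)
    (h.contMDiff.mdifferentiableAt (x := (0, p)) (by simp)).hasMFDerivAt hd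
  have hg := congrArg (fun l : ℝ →L[ℝ] E => l 1) hc.mfderiv
  refine Bundle.TotalSpace.ext (h.map_zero p).symm (heq_of_eq ?_)
  exact hg

end IsSmoothFlow

/-- A field is recovered from its flow, so every statement about `A` can be made about `φ` alone. -/
theorem IsFlowOf.eq_flowGenerator (h : IsFlowOf I V φ) (p : M) : V p = flowGenerator I φ p := by
  have h1 := congrArg (fun l : ℝ →L[ℝ] E => l 1) (h.isMIntegralCurve p 0).mfderiv
  have h2 := one_smulRight_apply_one (E := E) (V (φ 0 p) : E)
  have h3 : (V (φ 0 p) : E) = V p := by rw [h.map_zero p]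
  exact (h3.symm.trans h2.symm).trans h1.symm

variable {E' : Type*} [NormedAddCommGroup E'] [NormedSpace ℝ E']
  {H' : Type*} [TopologicalSpace H'] {I' : ModelWithCorners ℝ E' H'}
  {M' : Type*} [TopologicalSpace M'] [ChartedSpace H' M']

/-- A map that intertwines two flows relates their generators. -/
theorem IsSmoothFlow.mfderiv_flowGenerator (h : IsSmoothFlow I φ) {φ' : ℝ → M' → M'} {f : M → M'}
    (hf : ∀ t p, f (φ t p) = φ' t (f p)) (p : M) (hd : MDifferentiableAt I I' f p) :
    mfderiv I I' f p (flowGenerator I φ p) = flowGenerator I' φ' (f p) := by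
  have h0 := h.hasMFDerivAt_zero p
  have h1 : HasMFDerivAt I I' f (φ 0 p) (mfderiv I I' f p) := by
    rw [h.map_zero]; exact hd.hasMFDerivAt
  have h2 := HasMFDerivAt.comp (0 : ℝ) h1 h0
  have h3 : f ∘ (fun t => φ t p) = fun t => φ' t (f p) := funext fun t => hf t p
  rw [h3] at h2
  have h4 := congrArg (fun l : ℝ →L[ℝ] E' => l 1) h2.mfderiv
  refine Eq.trans ?_ h4.symm
  refine congrArg (mfderiv I I' f p) ?_
  exact (one_smulRight_apply_one (E := E) (flowGenerator I φ p : E)).symm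

end Flows

/-! ### Lifting a flow to a covering -/

section LiftFlow

variable {X Z : Type*} [TopologicalSpace X] [TopologicalSpace Z] {p : Z → X}

/-- A continuous flow on the base of a covering map lifts to the total space. -/
theorem IsCoveringMap.exists_lift_flow (hp : IsCoveringMap p) {φ : ℝ → X → X}
    (hc : Continuous fun z : ℝ × X => φ z.1 z.2) (h0 : ∀ x, φ 0 x = x) :
    ∃ ψ : ℝ → Z → Z, (Continuous fun z : ℝ × Z => ψ z.1 z.2) ∧ (∀ z, ψ 0 z = z) ∧
      ∀ t z, p (ψ t z) = φ t (p z) := by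
  have hpc := hp.continuous
  -- Homotopy lifting needs a parameter in the unit interval, so the orbit up to time `t` is
  -- rescaled to `s ↦ φ (s t) (p z)`. The lift starts at `z`, and its value at `s = 1` is the lifted
  -- flow at time `t`.
  let K : C(unitInterval × (ℝ × Z), X) :=
    ⟨fun w => φ (w.1 * w.2.1) (p w.2.2), hc.comp (by fun_prop :
      Continuous fun w : unitInterval × (ℝ × Z) => ((w.1 * w.2.1 : ℝ), p w.2.2))⟩
  have hK : ∀ a : ℝ × Z, K (0, a) = p ((⟨Prod.snd, continuous_snd⟩ : C(ℝ × Z, Z)) a) := by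
    intro a
    simp [K, h0]
  refine ⟨fun t z => hp.liftHomotopy K _ hK (1, (t, z)), ?_, fun z => ?_, fun t z => ?_⟩
  · exact (hp.liftHomotopy K _ hK).continuous.comp (by fun_prop)
  · have h1 := hp.eq_of_comp_eq (A := unitInterval)
      (g₁ := fun s => hp.liftHomotopy K _ hK (s, (0, z))) (g₂ := fun _ => z)
      ((hp.liftHomotopy K _ hK).continuous.comp (by fun_prop)) continuous_const
      (funext fun s => ?_) 0 (hp.liftHomotopy_zero K _ hK _)
    · exact congrFun h1 1
    · have := congrFun (hp.liftHomotopy_lifts K _ hK) (s, (0, z))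
      simpa [K, h0] using this
  · have := congrFun (hp.liftHomotopy_lifts K _ hK) (1, (t, z))
    simpa [K] using this

variable {φ : ℝ → X → X} {ψ : ℝ → Z → Z}

/-- The lift of a flow to a covering is a flow. -/
theorem IsCoveringMap.lift_flow_add (hp : IsCoveringMap p)
    (hψ : Continuous fun z : ℝ × Z => ψ z.1 z.2) (h0 : ∀ z, ψ 0 z = z)
    (hl : ∀ t z, p (ψ t z) = φ t (p z)) (hφ : ∀ s t x, φ (s + t) x = φ s (φ t x)) (s t : ℝ)
    (z : Z) : ψ (s + t) z = ψ s (ψ t z) := by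
  -- For fixed `t` and `z`, both sides are lifts of the same path in `s` that agree at `s = 0`.
  refine congrFun (hp.eq_of_comp_eq (g₁ := fun s => ψ (s + t) z) (g₂ := fun s => ψ s (ψ t z))
    (hψ.comp (by fun_prop : Continuous fun s : ℝ => (s + t, z)))
    (hψ.comp (by fun_prop : Continuous fun s : ℝ => (s, ψ t z)))
    (funext fun s => ?_) 0 ?_) s
  · simp [hl, hφ]
  · simp [h0]

/-- The lift of a flow to a covering commutes with the deck transformations. -/
theorem IsCoveringMap.lift_flow_deck (hp : IsCoveringMap p)
    (hψ : Continuous fun z : ℝ × Z => ψ z.1 z.2) (h0 : ∀ z, ψ 0 z = z)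
    (hl : ∀ t z, p (ψ t z) = φ t (p z)) {T : Z → Z} (hT : Continuous T)
    (hpT : ∀ z, p (T z) = p z) (t : ℝ) (z : Z) : ψ t (T z) = T (ψ t z) := by
  refine congrFun (hp.eq_of_comp_eq (g₁ := fun t => ψ t (T z)) (g₂ := fun t => T (ψ t z))
    (hψ.comp (by fun_prop : Continuous fun s : ℝ => (s, T z)))
    (hT.comp (hψ.comp (by fun_prop : Continuous fun s : ℝ => (s, z))))
    (funext fun s => ?_) 0 ?_) t
  · simp [hl, hpT]
  · simp [h0]

end LiftFlow

namespace HomothetyRep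

variable {n : ℕ}
  {L : Type*} [TopologicalSpace L] [ChartedSpace (EuclideanSpace ℝ (Fin n)) L]
  {Lt : Type*} [TopologicalSpace Lt] [ChartedSpace (EuclideanSpace ℝ (Fin n)) Lt]
  (S : HomothetyRep n L Lt)

/-- A smooth flow on `L` lifts to a smooth flow on `Lt`, which commutes with the deck
transformations. -/
theorem exists_lift_smoothFlow {φ : ℝ → L → L} (hφ : IsSmoothFlow (𝓡 n) φ) :
    ∃ ψ : ℝ → Lt → Lt, IsSmoothFlow (𝓡 n) ψ ∧ (∀ t y, S.proj (ψ t y) = φ t (S.proj y)) ∧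
      ∀ (T : S.Γ) t y, ψ t (T.1 y) = T.1 (ψ t y) := by
  obtain ⟨ψ, hc, h0, hl⟩ := S.isCoveringMap.exists_lift_flow hφ.contMDiff.continuous hφ.map_zero
  refine ⟨ψ, ⟨fun z => ?_, h0, S.isCoveringMap.lift_flow_add hc h0 hl hφ.map_add⟩, hl, fun T =>
    S.isCoveringMap.lift_flow_deck hc h0 hl T.1.continuous T.2⟩
  refine (S.isLocalDiffeomorph _).contMDiffAt_of_comp (f := fun z : ℝ × Lt => ψ z.1 z.2)
    hc.continuousAt ?_
  have h1 : S.proj ∘ (fun z : ℝ × Lt => ψ z.1 z.2) =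
      (fun z : ℝ × L => φ z.1 z.2) ∘ Prod.map id S.proj := funext fun z => hl _ _
  rw [h1]
  exact (hφ.contMDiff.comp (contMDiff_id.prodMap S.isLocalDiffeomorph.contMDiff)) z

variable [ConnectedSpace Lt]

/-- Deck transformations act freely. -/
theorem eq_one_of_deck_fixed {T : S.Γ} {y : Lt} (h : T.1 y = y) : T = 1 :=
  Subtype.ext (Homeomorph.ext fun u => congrFun (S.isCoveringMap.eq_of_comp_eq T.1.continuous
    continuous_id (funext fun u => T.2 u) y h) u)

/-- The charts of `M` are built from local inverses at chosen representatives. Any other local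
inverse differs from these, locally, by a deck transformation, which acts smoothly. -/
theorem isLocalDiffeomorph_projM [IsManifold (𝓡 n) ∞ Lt] :
    IsLocalDiffeomorph (model n) (model n) ∞ S.projM := by
  intro z
  have hsymm := S.isLocalHomeomorph_projM.localInverseAt_symm z
  set s := S.isLocalHomeomorph_projM.localInverseAt z with hs
  refine ⟨⟨s.symm.toPartialEquiv, s.open_target, s.open_source, ?_, ?_⟩, ?_, ?_⟩
  · change ContMDiffOn _ _ _ s.symm _
    rw [hsymm]
    exact S.contMDiff_projM.contMDiffOn
  · intro q hq
    refine ContMDiffAt.contMDiffWithinAt ?_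
    have hg := S.projM_surjective.hasRightInverse.choose_spec
    set v := S.projM_surjective.hasRightInverse.choose q with hv
    have hpv : S.projM v = q := hg _
    set r := S.isLocalHomeomorph_projM.localInverseAt v with hr
    have hqr : q ∈ r.source := by
      rw [← hpv]
      exact S.isLocalHomeomorph_projM.apply_self_mem_localInverseAt_source
    have hrq : r q = v := by
      rw [← hpv]
      exact S.isLocalHomeomorph_projM.localInverseAt_apply_self
    -- By construction the chart at `q` is the chart at `v` after `r`; undoing the latter chart
    -- shows that `r` is smooth.
    have hext : ∀ u, extChartAt (model n) q u = extChartAt (model n) v (r u) := fun u => rfl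
    have hsm : ContMDiffAt (model n) (model n) ∞ r q := by
      have h1 : ContMDiffAt 𝓘(ℝ, ℝ × EuclideanSpace ℝ (Fin n)) (model n) ∞
          (extChartAt (model n) v).symm (extChartAt (model n) q q) := by
        rw [hext, hrq]
        exact (contMDiffOn_extChartAt_symm v).contMDiffAt (extChartAt_target_mem_nhds v)
      refine (ContMDiffAt.comp q h1 contMDiffAt_extChartAt).congr_of_eventuallyEq ?_
      have hr2 : ContinuousAt r q := r.continuousAt hqr
      have h3 : ∀ᶠ u in 𝓝 q, r u ∈ (extChartAt (model n) v).source :=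
        hr2.eventually (by rw [hrq]; exact extChartAt_source_mem_nhds v)
      filter_upwards [h3] with u hu
      rw [Function.comp_apply, hext, (extChartAt (model n) v).left_inv hu]
    obtain ⟨T, hT⟩ := S.exists_eventually_localInverse z v (by rw [hpv]; exact hq)
    have h5 : ContMDiffAt (model n) (model n) ∞ (fun u => T • r u) q :=
      (S.contMDiff_smul T).contMDiffAt.comp q hsm
    refine h5.congr_of_eventuallyEq ?_
    have hr2 : ContinuousAt r q := r.continuousAt hqr
    have h6 := hr2.eventually (by rw [hrq]; exact hT)
    filter_upwards [h6, r.open_source.mem_nhds hqr] with u hu hur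
    rw [S.isLocalHomeomorph_projM.apply_localInverseAt_of_mem hur] at hu
    exact hu
  · exact S.isLocalHomeomorph_projM.self_mem_localInverseAt_target
  · intro u _
    exact (congrFun hsymm u).symm

/-! ### The suspension of a flow -/

/-- The flow on the suspension induced by `(x, y) ↦ (e^{κ t} x, ψ t y)`. -/
noncomputable def suspFlow (κ : ℝ) {ψ : ℝ → Lt → Lt}
    (hψ : ∀ (T : S.Γ) t y, ψ t (T.1 y) = T.1 (ψ t y)) (t : ℝ) : S.M → S.M :=
  Quotient.lift (fun z : ℝ × Lt => S.projM (Real.exp (t * κ) * z.1, ψ t z.2)) (by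
    rintro _ z ⟨T, rfl⟩
    obtain ⟨a, -, ha⟩ := S.h_homothety T
    refine S.projM_eq_iff.2 ⟨T, ?_⟩
    change (S.h T (Real.exp (t * κ) * z.1), T.1 (ψ t z.2)) =
      (Real.exp (t * κ) * S.h T z.1, ψ t (T.1 z.2))
    -- The flow is well defined because the factor `e^{tκ}` commutes with the homothety `x ↦ a x` of
    -- `T`.
    rw [hψ, ha, ha, mul_left_comm])

variable (κ : ℝ) {ψ : ℝ → Lt → Lt} (hψ : ∀ (T : S.Γ) t y, ψ t (T.1 y) = T.1 (ψ t y))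

theorem suspFlow_projM (t : ℝ) (z : ℝ × Lt) :
    S.suspFlow κ hψ t (S.projM z) = S.projM (Real.exp (t * κ) * z.1, ψ t z.2) := rfl

theorem isSmoothFlow_homothety (κ : ℝ) :
    IsSmoothFlow 𝓘(ℝ, ℝ) (fun (t x : ℝ) => Real.exp (t * κ) * x) where
  contMDiff := by
    -- Replaces the product manifold structure on `ℝ × ℝ` by that of a normed space, where
    -- smoothness is ordinary calculus.
    rw [← modelWithCornersSelf_prod, chartedSpaceSelf_prod]
    exact ContDiff.contMDiff (by fun_prop)
  map_zero x := by simp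
  map_add s t x := by rw [add_mul, Real.exp_add, mul_assoc]

theorem flowGenerator_homothety (κ x : ℝ) :
    flowGenerator 𝓘(ℝ, ℝ) (fun (t x : ℝ) => Real.exp (t * κ) * x) x = κ * x := by
  have h : HasDerivAt (fun t : ℝ => Real.exp (t * κ) * x) (κ * x) 0 := by
    have := (((hasDerivAt_id (0 : ℝ)).mul_const κ).exp).mul_const x
    simpa using this
  have h1 := h.hasFDerivAt.hasMFDerivAt.mfderiv
  refine (congrArg (fun l : ℝ →L[ℝ] ℝ => l 1) h1).trans ?_
  simp

end HomothetyRep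

/-! ### Products of flows -/

section ProdFlow

variable {E : Type*} [NormedAddCommGroup E] [NormedSpace ℝ E]
  {H : Type*} [TopologicalSpace H] {I : ModelWithCorners ℝ E H}
  {M : Type*} [TopologicalSpace M] [ChartedSpace H M]
  {E' : Type*} [NormedAddCommGroup E'] [NormedSpace ℝ E']
  {H' : Type*} [TopologicalSpace H'] {I' : ModelWithCorners ℝ E' H'}
  {M' : Type*} [TopologicalSpace M'] [ChartedSpace H' M']
  {φ : ℝ → M → M} {φ' : ℝ → M' → M'}

theorem IsSmoothFlow.prod (h : IsSmoothFlow I φ) (h' : IsSmoothFlow I' φ') :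
    IsSmoothFlow (I.prod I') (fun t (z : M × M') => (φ t z.1, φ' t z.2)) where
  contMDiff := (h.contMDiff.comp (contMDiff_fst.prodMk (contMDiff_fst.comp contMDiff_snd))).prodMk
    (h'.contMDiff.comp (contMDiff_fst.prodMk (contMDiff_snd.comp contMDiff_snd)))
  map_zero _ := Prod.ext (h.map_zero _) (h'.map_zero _)
  map_add _ _ _ := Prod.ext (h.map_add _ _ _) (h'.map_add _ _ _)

theorem IsSmoothFlow.flowGenerator_prod (h : IsSmoothFlow I φ) (h' : IsSmoothFlow I' φ')
    (z : M × M') : flowGenerator (I.prod I') (fun t (z : M × M') => (φ t z.1, φ' t z.2)) z =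
      ((flowGenerator I φ z.1, flowGenerator I' φ' z.2) : E × E') := by
  have h1 := ((h.hasMFDerivAt_zero z.1).prodMk (h'.hasMFDerivAt_zero z.2)).mfderiv
  refine (congrArg (fun l : ℝ →L[ℝ] E × E' => l 1) h1).trans ?_
  exact Prod.ext (one_smulRight_apply_one (E := E) _) (one_smulRight_apply_one (E := E') _)

end ProdFlow

/-! ### Smoothness and generator of the suspension flow -/

namespace HomothetyRep

variable {n : ℕ}
  {L : Type*} [TopologicalSpace L] [ChartedSpace (EuclideanSpace ℝ (Fin n)) L]
  {Lt : Type*} [TopologicalSpace Lt] [ChartedSpace (EuclideanSpace ℝ (Fin n)) Lt]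
  (S : HomothetyRep n L Lt) [ConnectedSpace Lt] [IsManifold (𝓡 n) ∞ Lt]
  (κ : ℝ) {ψ : ℝ → Lt → Lt} (hψ : ∀ (T : S.Γ) t y, ψ t (T.1 y) = T.1 (ψ t y))

theorem isSmoothFlow_suspFlow (hs : IsSmoothFlow (𝓡 n) ψ) :
    IsSmoothFlow (model n) (S.suspFlow κ hψ) := by
  have hprod := (isSmoothFlow_homothety κ).prod hs
  refine ⟨?_, fun q => ?_, fun s t q => ?_⟩
  · rintro ⟨t, q⟩
    obtain ⟨z, rfl⟩ := S.projM_surjective q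
    have hz := S.isLocalDiffeomorph_projM z
    have hzz : hz.localInverse (S.projM z) = z := hz.localInverse_left_inv hz.localInverse_mem_target
    have h1 : ContMDiffAt (𝓘(ℝ, ℝ).prod (model n)) (𝓘(ℝ, ℝ).prod (model n)) ∞
        (Prod.map id hz.localInverse : ℝ × S.M → ℝ × (ℝ × Lt)) (t, S.projM z) :=
      contMDiffAt_id.prodMap' hz.localInverse_contMDiffAt
    have h2 := ((S.contMDiff_projM.comp hprod.contMDiff) _).comp (t, S.projM z) h1
    refine h2.congr_of_eventuallyEq ?_
    have h3 : Filter.Tendsto Prod.snd (𝓝 (t, S.projM z)) (𝓝 (S.projM z)) := continuousAt_snd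
    filter_upwards [h3.eventually hz.localInverse_eventuallyEq_right] with u hu
    have hu' : S.projM (hz.localInverse u.2) = u.2 := hu
    -- Near `S.projM z` the flow is the product flow read through a local inverse of the projection.
    conv_lhs => rw [← hu']
    rfl
  · obtain ⟨z, rfl⟩ := S.projM_surjective q
    exact congrArg S.projM (hprod.map_zero z)
  · obtain ⟨z, rfl⟩ := S.projM_surjective q
    exact congrArg S.projM (hprod.map_add s t z)

theorem flowGenerator_suspFlow (hs : IsSmoothFlow (𝓡 n) ψ) (z : ℝ × Lt) :
    flowGenerator (model n) (S.suspFlow κ hψ) (S.projM z) =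
      mfderiv (model n) (model n) S.projM z
        ((κ * z.1, flowGenerator (𝓡 n) ψ z.2) : ℝ × EuclideanSpace ℝ (Fin n)) := by
  have hprod := (isSmoothFlow_homothety κ).prod hs
  rw [← hprod.mfderiv_flowGenerator (f := S.projM) (fun t z => (S.suspFlow_projM κ hψ t z).symm) z
    (S.contMDiff_projM.mdifferentiableAt (by simp)),
    (isSmoothFlow_homothety κ).flowGenerator_prod hs, flowGenerator_homothety]

end HomothetyRep

/-! ### Exponentials of products and conjugates of endomorphisms -/

section Exp

variable {E F : Type*} [NormedAddCommGroup E] [NormedSpace ℝ E]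
  [NormedAddCommGroup F] [NormedSpace ℝ F]

/-- The product of endomorphisms, as a ring homomorphism. -/
def ContinuousLinearMap.prodMapRingHom (E F : Type*) [NormedAddCommGroup E] [NormedSpace ℝ E]
    [NormedAddCommGroup F] [NormedSpace ℝ F] :
    (E →L[ℝ] E) × (F →L[ℝ] F) →+* (E × F →L[ℝ] E × F) where
  toFun a := a.1.prodMap a.2
  map_one' := by ext <;> simp
  map_mul' a b := by ext <;> simp
  map_zero' := by ext <;> simp
  map_add' a b := by ext <;> simp

theorem ContinuousLinearMap.exp_prodMap [CompleteSpace E] [CompleteSpace F] (f : E →L[ℝ] E)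
    (g : F →L[ℝ] F) :
    NormedSpace.exp (f.prodMap g) = (NormedSpace.exp f).prodMap (NormedSpace.exp g) := by
  have hc : Continuous (prodMapRingHom E F) := (ContinuousLinearMap.prodMapL ℝ E E F F).continuous
  -- `NormedSpace.map_exp` works over the rationals, so scalars are restricted from `ℝ`.
  let : NormedAlgebra ℚ (E →L[ℝ] E) := NormedAlgebra.restrictScalars ℚ ℝ _
  let : NormedAlgebra ℚ (F →L[ℝ] F) := NormedAlgebra.restrictScalars ℚ ℝ _
  let : NormedAlgebra ℚ (E × F →L[ℝ] E × F) := NormedAlgebra.restrictScalars ℚ ℝ _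
  refine (NormedSpace.map_exp (prodMapRingHom E F) hc (f, g)).symm.trans ?_
  change (NormedSpace.exp (f, g)).1.prodMap (NormedSpace.exp (f, g)).2 = _
  rw [Prod.fst_exp, Prod.snd_exp]

theorem ContinuousLinearMap.exp_smul_id (r : ℝ) :
    NormedSpace.exp (r • ContinuousLinearMap.id ℝ E) =
      Real.exp r • ContinuousLinearMap.id ℝ E := by
  have h := NormedSpace.algebraMap_exp_comm (𝔸 := E →L[ℝ] E) r
  rw [Algebra.algebraMap_eq_smul_one, Algebra.algebraMap_eq_smul_one, ← Real.exp_eq_exp_ℝ] at h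
  exact h.symm

theorem ContinuousLinearEquiv.exp_conj [CompleteSpace E] (P : E ≃L[ℝ] F) (f : E →L[ℝ] E) :
    NormedSpace.exp (P.conjContinuousAlgEquiv f) = P.conjContinuousAlgEquiv (NormedSpace.exp f) := by
  let : NormedAlgebra ℚ (E →L[ℝ] E) := NormedAlgebra.restrictScalars ℚ ℝ _
  let : NormedAlgebra ℚ (F →L[ℝ] F) := NormedAlgebra.restrictScalars ℚ ℝ _
  exact (NormedSpace.map_exp P.conjContinuousAlgEquiv P.conjContinuousAlgEquiv.continuous f).symm

end Exp

/-! ### Simple fixed points under conjugation and products -/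

section SimpleFixedPoints

variable {E : Type*} [NormedAddCommGroup E] [NormedSpace ℝ E]
  {H : Type*} [TopologicalSpace H] {I : ModelWithCorners ℝ E H}
  {M : Type*} [TopologicalSpace M] [ChartedSpace H M]
  {E' : Type*} [NormedAddCommGroup E'] [NormedSpace ℝ E']
  {H' : Type*} [TopologicalSpace H'] {I' : ModelWithCorners ℝ E' H'}
  {M' : Type*} [TopologicalSpace M'] [ChartedSpace H' M']
  {φ : ℝ → M → M} {φ' : ℝ → M' → M'}

/-- The chain rule for a map that intertwines two flows, at a fixed point. -/
theorem diffEnd_mfderiv (h : IsSmoothFlow I φ) (h' : IsSmoothFlow I' φ') {f : M → M'}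
    (hf : ∀ t p, f (φ t p) = φ' t (f p)) {p : M} (hd : MDifferentiableAt I I' f p)
    (hp : ∀ t, φ t p = p) (t : ℝ) (v : E) :
    diffEnd I' (φ' t) (f p) (mfderiv I I' f p v) = mfderiv I I' f p (diffEnd I (φ t) p v) := by
  have h1 := (((h'.contMDiff_time t).mdifferentiableAt (x := f p) (by simp)).hasMFDerivAt).comp p
    hd.hasMFDerivAt
  have hd' : HasMFDerivAt I I' f (φ t p) (mfderiv I I' f p) := by
    rw [hp]
    exact hd.hasMFDerivAt
  have h2 := hd'.comp p ((h.contMDiff_time t).mdifferentiableAt (x := p) (by simp)).hasMFDerivAt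
  have h3 : f ∘ φ t = φ' t ∘ f := funext fun q => hf t q
  rw [h3] at h2
  exact congrArg (fun l : E →L[ℝ] E' => l v) (h1.mfderiv.symm.trans h2.mfderiv)

/-- If `A` generates the linearized flow at `p`, then `P A P⁻¹` generates the one at `p'`, since
conjugation commutes with `exp`; it also preserves invertibility. -/
theorem IsSimpleFixedPoint.of_conj [CompleteSpace E] {p : M} {p' : M'} (P : E ≃L[ℝ] E')
    (hP : ∀ t v, diffEnd I' (φ' t) p' (P v) = P (diffEnd I (φ t) p v))
    (hs : IsSimpleFixedPoint I φ p) : IsSimpleFixedPoint I' φ' p' := by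
  obtain ⟨A, hA, hu⟩ := hs
  refine ⟨P.conjContinuousAlgEquiv A, fun t => ?_, hu.map P.conjContinuousAlgEquiv⟩
  rw [← map_smul, P.exp_conj, ← hA t]
  refine ContinuousLinearMap.ext fun v => ?_
  have h := hP t (P.symm v)
  rw [P.apply_symm_apply] at h
  exact h

/-- A local diffeomorphism that intertwines two flows preserves and reflects simple fixed
points. -/
theorem isSimpleFixedPoint_iff_of_isLocalDiffeomorphAt [CompleteSpace E] [CompleteSpace E']
    (h : IsSmoothFlow I φ) (h' : IsSmoothFlow I' φ')
    {f : M → M'} (hf : ∀ t p, f (φ t p) = φ' t (f p)) {p : M}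
    (hd : IsLocalDiffeomorphAt I I' ∞ f p) (hp : ∀ t, φ t p = p) :
    IsSimpleFixedPoint I φ p ↔ IsSimpleFixedPoint I' φ' (f p) := by
  let P : E ≃L[ℝ] E' := hd.mfderivToContinuousLinearEquiv (by simp)
  have hP : ∀ t v, diffEnd I' (φ' t) (f p) (P v) = P (diffEnd I (φ t) p v) :=
    diffEnd_mfderiv h h' hf (hd.mdifferentiableAt (by simp)) hp
  refine ⟨IsSimpleFixedPoint.of_conj P hP, IsSimpleFixedPoint.of_conj P.symm fun t v => ?_⟩
  rw [P.eq_symm_apply, ← hP, P.apply_symm_apply]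

/-- The product of two simple fixed points is a simple fixed point. -/
theorem IsSimpleFixedPoint.prod [CompleteSpace E] [CompleteSpace E']
    (h : IsSmoothFlow I φ) (h' : IsSmoothFlow I' φ') {p : M} {p' : M'}
    (hs : IsSimpleFixedPoint I φ p) (hs' : IsSimpleFixedPoint I' φ' p') :
    IsSimpleFixedPoint (I.prod I') (fun t (z : M × M') => (φ t z.1, φ' t z.2)) (p, p') := by
  obtain ⟨A, hA, hu⟩ := hs
  obtain ⟨A', hA', hu'⟩ := hs'
  refine ⟨A.prodMap A', fun t => ?_, ?_⟩
  · have h1 := HasMFDerivAt.prodMap (p := (p, p'))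
      ((h.contMDiff_time t).mdifferentiableAt (x := p) (by simp)).hasMFDerivAt
      ((h'.contMDiff_time t).mdifferentiableAt (x := p') (by simp)).hasMFDerivAt
    have h2 : t • A.prodMap A' = (t • A).prodMap (t • A') := by ext <;> simp
    rw [h2, ContinuousLinearMap.exp_prodMap, ← hA, ← hA']
    exact h1.mfderiv
  · exact (Prod.isUnit_iff.2 ⟨hu, hu'⟩ : IsUnit (A, A')).map
      (ContinuousLinearMap.prodMapRingHom E E')

end SimpleFixedPoints

theorem isSimpleFixedPoint_homothety {κ : ℝ} (hκ : κ ≠ 0) :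
    IsSimpleFixedPoint 𝓘(ℝ, ℝ) (fun (t x : ℝ) => Real.exp (t * κ) * x) 0 := by
  refine ⟨κ • ContinuousLinearMap.id ℝ ℝ, fun t => ?_, ?_⟩
  · rw [smul_smul, ContinuousLinearMap.exp_smul_id]
    exact ((hasFDerivAt_id (0 : ℝ)).const_smul (Real.exp (t * κ))).hasMFDerivAt.mfderiv
  · exact (IsUnit.mk0 κ hκ).map (algebraMap ℝ (ℝ →L[ℝ] ℝ))

/-! ### Brackets with leafwise fields and foliated fields -/

theorem two_le_infty : (2 : ℕ∞ω) ≤ ∞ :=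
  WithTop.coe_le_coe.2 (le_top : (2 : ℕ∞) ≤ ⊤)

/-- The first component of `[V, W]` is `dW₁(V) - dV₁(W)`. Here `W₁ = 0` near the point kills the
first term, and the second is `κ W₁ = 0`. No differentiability is needed: where it fails, `fderiv`
takes the default value `0`. -/
theorem fst_lieBracket_eq_zero {E : Type*} [NormedAddCommGroup E] [NormedSpace ℝ E]
    {V W : ℝ × E → ℝ × E} {x₀ : ℝ × E} {κ : ℝ} (hV : ∀ᶠ x in 𝓝 x₀, (V x).1 = κ * x.1)
    (hW : ∀ᶠ x in 𝓝 x₀, (W x).1 = 0) : (VectorField.lieBracket ℝ V W x₀).1 = 0 := by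
  have h1 : (fderiv ℝ W x₀ (V x₀)).1 = 0 := by
    by_cases hd : DifferentiableAt ℝ W x₀
    · have h := (hasFDerivAt_fst (𝕜 := ℝ)).comp x₀ hd.hasFDerivAt
      have h' : HasFDerivAt (Prod.fst ∘ W) (0 : ℝ × E →L[ℝ] ℝ) x₀ :=
        (hasFDerivAt_const (0 : ℝ) x₀).congr_of_eventuallyEq hW
      exact DFunLike.congr_fun (h.unique h') (V x₀)
    · simp [fderiv_zero_of_not_differentiableAt hd]
  have h2 : (fderiv ℝ V x₀ (W x₀)).1 = 0 := by
    by_cases hd : DifferentiableAt ℝ V x₀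
    · have h := (hasFDerivAt_fst (𝕜 := ℝ)).comp x₀ hd.hasFDerivAt
      have h' : HasFDerivAt (Prod.fst ∘ V) (κ • ContinuousLinearMap.fst ℝ ℝ E) x₀ :=
        (hasFDerivAt_fst.const_mul κ).congr_of_eventuallyEq hV
      have h3 := DFunLike.congr_fun (h.unique h') (W x₀)
      refine h3.trans ?_
      simp [hW.self_of_nhds]
    · simp [fderiv_zero_of_not_differentiableAt hd]
  rw [VectorField.lieBracket, Prod.fst_sub, h1, h2, sub_zero]

theorem fst_mlieBracket_eq_zero {E : Type*} [NormedAddCommGroup E] [NormedSpace ℝ E]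
    {V W : ℝ × E → ℝ × E} {x₀ : ℝ × E} {κ : ℝ} (hV : ∀ᶠ x in 𝓝 x₀, (V x).1 = κ * x.1)
    (hW : ∀ᶠ x in 𝓝 x₀, (W x).1 = 0) :
    (VectorField.mlieBracket 𝓘(ℝ, ℝ × E) V W x₀ : ℝ × E).1 = 0 := by
  have h : VectorField.mlieBracket 𝓘(ℝ, ℝ × E) V W = VectorField.lieBracket ℝ V W :=
    (VectorField.mlieBracketWithin_univ (I := 𝓘(ℝ, ℝ × E)) (V := V) (W := W)).symm.trans
      (VectorField.mlieBracketWithin_eq_lieBracketWithin.trans VectorField.lieBracketWithin_univ)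
  exact (congrArg Prod.fst (congrFun h x₀)).trans (fst_lieBracket_eq_zero hV hW)

namespace HomothetyRep

variable {n : ℕ}
  {L : Type*} [TopologicalSpace L] [ChartedSpace (EuclideanSpace ℝ (Fin n)) L]
  {Lt : Type*} [TopologicalSpace Lt] [ChartedSpace (EuclideanSpace ℝ (Fin n)) Lt]
  (S : HomothetyRep n L Lt)

/-- The inverse of a chart of `ℝ × Lt` preserves the first component of tangent vectors. -/
theorem fst_mfderiv_extChartAt_symm [IsManifold (𝓡 n) ∞ Lt] {z : ℝ × Lt}
    {x : ℝ × EuclideanSpace ℝ (Fin n)} (hx : x ∈ (extChartAt (model n) z).target) (ξ : ℝ × EuclideanSpace ℝ (Fin n)) :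
    (mfderiv 𝓘(ℝ, ℝ × EuclideanSpace ℝ (Fin n)) (model n) (extChartAt (model n) z).symm x ξ :
      ℝ × EuclideanSpace ℝ (Fin n)).1 = ξ.1 := by
  have h1 : MDifferentiableAt 𝓘(ℝ, ℝ × EuclideanSpace ℝ (Fin n)) (model n)
      (extChartAt (model n) z).symm x :=
    ((contMDiffOn_extChartAt_symm (n := ∞) z).contMDiffAt
      ((isOpen_extChartAt_target z).mem_nhds hx)).mdifferentiableAt (by simp)
  have h2 := HasMFDerivAt.comp x
    (hasMFDerivAt_fst (I := 𝓘(ℝ, ℝ)) (I' := 𝓡 n) ((extChartAt (model n) z).symm x)) h1.hasMFDerivAt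
  have h3 : Prod.fst ∘ (extChartAt (model n) z).symm =
      (Prod.fst : ℝ × EuclideanSpace ℝ (Fin n) → ℝ) := rfl
  rw [h3] at h2
  let D : ℝ × EuclideanSpace ℝ (Fin n) →L[ℝ] ℝ × EuclideanSpace ℝ (Fin n) :=
    mfderiv 𝓘(ℝ, ℝ × EuclideanSpace ℝ (Fin n)) (model n) (extChartAt (model n) z).symm x
  have h4 : HasFDerivAt (Prod.fst : ℝ × EuclideanSpace ℝ (Fin n) → ℝ)
      ((ContinuousLinearMap.fst ℝ ℝ (EuclideanSpace ℝ (Fin n))) ∘L D) x := h2.hasFDerivAt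
  exact DFunLike.congr_fun (h4.unique hasFDerivAt_fst) ξ

variable [ConnectedSpace Lt]

theorem mem_leafTangent_iff {z : ℝ × Lt} {v : TangentSpace (model n) (S.projM z)} :
    v ∈ S.leafTangent z ↔ ∃ η : ℝ × EuclideanSpace ℝ (Fin n), η.1 = 0 ∧
      mfderiv (model n) (model n) S.projM z η = v := by
  constructor
  · rintro ⟨η, ⟨h1, -⟩, h2⟩
    exact ⟨η, h1, h2⟩
  · rintro ⟨η, h1, h2⟩
    exact ⟨η, ⟨h1, trivial⟩, h2⟩

variable [IsManifold (𝓡 n) ∞ Lt]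

theorem mfderiv_projM_injective (z : ℝ × Lt) :
    Function.Injective (mfderiv (model n) (model n) S.projM z) :=
  (S.isLocalDiffeomorph_projM z).mfderiv_injective (by simp)

/-- Allows the transverse component of a field on `M`, pulled back to chart coordinates, to be read
from any lift `η` of its value to `ℝ × Lt`: charts of `ℝ × Lt` do not alter the first coordinate. -/
theorem fst_mpullback {z : ℝ × Lt} {x η : ℝ × EuclideanSpace ℝ (Fin n)}
    (hx : x ∈ (extChartAt (model n) z).target) {V : (q : S.M) → TangentSpace (model n) q}
    (hV : mfderiv (model n) (model n) S.projM ((extChartAt (model n) z).symm x) η =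
      V (S.projM ((extChartAt (model n) z).symm x))) :
    (VectorField.mpullback 𝓘(ℝ, ℝ × EuclideanSpace ℝ (Fin n)) (model n)
      (S.projM ∘ (extChartAt (model n) z).symm) V x : ℝ × EuclideanSpace ℝ (Fin n)).1 = η.1 := by
  have : IsManifold (model n) 1 (ℝ × Lt) := IsManifold.of_le (n := ∞) (by simp)
  have h1 : MDifferentiableAt 𝓘(ℝ, ℝ × EuclideanSpace ℝ (Fin n)) (model n)
      (extChartAt (model n) z).symm x :=
    ((contMDiffOn_extChartAt_symm (n := ∞) z).contMDiffAt
      ((isOpen_extChartAt_target z).mem_nhds hx)).mdifferentiableAt (by simp)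
  have h2 := mfderiv_comp x (S.contMDiff_projM.mdifferentiableAt (by simp)) h1
  have h3 := isInvertible_mfderivWithin_extChartAt_symm hx
  rw [ModelWithCorners.range_eq_univ, mfderivWithin_univ] at h3
  have h4 : (mfderiv (model n) (model n) S.projM
      ((extChartAt (model n) z).symm x)).IsInvertible :=
    ⟨(S.isLocalDiffeomorph_projM _).mfderivToContinuousLinearEquiv (by simp), rfl⟩
  have h5 := h4.comp h3
  rw [← h2] at h5
  set ξ := VectorField.mpullback 𝓘(ℝ, ℝ × EuclideanSpace ℝ (Fin n)) (model n)
      (S.projM ∘ (extChartAt (model n) z).symm) V x with hξ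
  have h6 : mfderiv 𝓘(ℝ, ℝ × EuclideanSpace ℝ (Fin n)) (model n)
      (S.projM ∘ (extChartAt (model n) z).symm) x ξ =
      V (S.projM ((extChartAt (model n) z).symm x)) := h5.self_apply_inverse _
  rw [h2, ← hV] at h6
  have h7 := S.mfderiv_projM_injective _ h6
  rw [← fst_mfderiv_extChartAt_symm hx ξ]
  exact congrArg Prod.fst h7

/-- Brackets commute with pullback by a local diffeomorphism, so the question moves to a chart of `ℝ
× Lt`, where `fst_mlieBracket_eq_zero` applies. -/
theorem mlieBracket_mem_leafTangent {κ : ℝ} {V W : (q : S.M) → TangentSpace (model n) q}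
    (hV : IsSmoothField (model n) V)
    (hV' : ∀ z : ℝ × Lt, ∃ η : ℝ × EuclideanSpace ℝ (Fin n), η.1 = κ * z.1 ∧
      mfderiv (model n) (model n) S.projM z η = V (S.projM z))
    (hW : S.IsLeafwise W) (z : ℝ × Lt) :
    VectorField.mlieBracket (model n) V W (S.projM z) ∈ S.leafTangent z := by
  set x₀ := extChartAt (model n) z z with hx₀
  have hx₀t : x₀ ∈ (extChartAt (model n) z).target := mem_extChartAt_target z
  have hz : (extChartAt (model n) z).symm x₀ = z := extChartAt_to_inv z
  have hsm : ContMDiffAt 𝓘(ℝ, ℝ × EuclideanSpace ℝ (Fin n)) (model n) ∞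
      (S.projM ∘ (extChartAt (model n) z).symm) x₀ :=
    (S.contMDiff_projM _).comp x₀ ((contMDiffOn_extChartAt_symm (n := ∞) z).contMDiffAt
      (extChartAt_target_mem_nhds z))
  have hev := (isOpen_extChartAt_target (I := model n) z).mem_nhds hx₀t
  have : IsManifold (model n) (minSmoothness ℝ 2) S.M := by
    rw [minSmoothness_of_isRCLikeNormedField]
    exact IsManifold.of_le (n := ∞) two_le_infty
  have hb := VectorField.mpullback_mlieBracket (n := ∞) (V := V) (W := W)
    (hV.mdifferentiable (by simp) _) (hW.1.mdifferentiable (by simp) _) hsm (by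
      rw [minSmoothness_of_isRCLikeNormedField]
      exact two_le_infty)
  have h0 : (VectorField.mlieBracket 𝓘(ℝ, ℝ × EuclideanSpace ℝ (Fin n))
      (VectorField.mpullback 𝓘(ℝ, ℝ × EuclideanSpace ℝ (Fin n)) (model n)
        (S.projM ∘ (extChartAt (model n) z).symm) V)
      (VectorField.mpullback 𝓘(ℝ, ℝ × EuclideanSpace ℝ (Fin n)) (model n)
        (S.projM ∘ (extChartAt (model n) z).symm) W) x₀ :
        ℝ × EuclideanSpace ℝ (Fin n)).1 = 0 := by
    refine fst_mlieBracket_eq_zero (κ := κ) ?_ ?_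
    · filter_upwards [hev] with x hx
      obtain ⟨η, h1, h2⟩ := hV' ((extChartAt (model n) z).symm x)
      rw [S.fst_mpullback hx h2, h1]
      rfl
    · filter_upwards [hev] with x hx
      obtain ⟨η, h1, h2⟩ := S.mem_leafTangent_iff.1 (hW.2 ((extChartAt (model n) z).symm x))
      rw [S.fst_mpullback hx h2, h1]
  have key : VectorField.mlieBracket (model n) V W (S.projM ((extChartAt (model n) z).symm x₀)) ∈
      S.leafTangent ((extChartAt (model n) z).symm x₀) := by
    let P := (S.isLocalDiffeomorph_projM ((extChartAt (model n) z).symm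
      x₀)).mfderivToContinuousLinearEquiv (by simp)
    obtain ⟨η, hη⟩ := P.surjective
      (VectorField.mlieBracket (model n) V W (S.projM ((extChartAt (model n) z).symm x₀)))
    refine S.mem_leafTangent_iff.2 ⟨η, ?_, hη⟩
    rw [← S.fst_mpullback hx₀t hη, hb]
    exact h0
  rwa [hz] at key

theorem isFoliated_of_fst {κ : ℝ} {V : (q : S.M) → TangentSpace (model n) q}
    (hV : IsSmoothField (model n) V)
    (hV' : ∀ z : ℝ × Lt, ∃ η : ℝ × EuclideanSpace ℝ (Fin n), η.1 = κ * z.1 ∧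
      mfderiv (model n) (model n) S.projM z η = V (S.projM z)) : S.IsFoliated V := by
  refine ⟨hV, fun W hW => ⟨?_, S.mlieBracket_mem_leafTangent hV hV' hW⟩⟩
  have : IsManifold (model n) (minSmoothness ℝ 2) S.M := by
    rw [minSmoothness_of_isRCLikeNormedField]
    exact IsManifold.of_le (n := ∞) two_le_infty
  -- The bracket loses one derivative, which is harmless since `∞ + 1` is `∞`.
  have : IsManifold (model n) (((⊤ : ℕ∞) : ℕ∞ω) + 1) S.M := S.isManifold
  exact ContDiff.mlieBracket_vectorField (m := ⊤) (n := ⊤) hV hW.1 (by simp)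

/-! ### Closed orbits of the suspension flow -/

variable {κ : ℝ} {ψ : ℝ → Lt → Lt} (hψ : ∀ (T : S.Γ) t y, ψ t (T.1 y) = T.1 (ψ t y))

/-- An integral curve of the suspension lifts to `ℝ × Lt`. -/
theorem exists_lift_integralCurve (hs : IsSmoothFlow (𝓡 n) ψ) {c : ℝ → S.M}
    (hc : IsMIntegralCurve (I := model n) c (flowGenerator (model n) (S.suspFlow κ hψ))) :
    ∃ (x : ℝ → ℝ) (y : ℝ → Lt), (∀ t, c t = S.projM (x t, y t)) ∧
      (∀ t, HasDerivAt x (κ * x t) t) ∧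
      IsMIntegralCurve (I := 𝓡 n) y (flowGenerator (𝓡 n) ψ) := by
  have hcont : Continuous c := continuous_iff_continuousAt.2 fun t => (hc t).continuousAt
  obtain ⟨z₀, hz₀⟩ := S.projM_surjective (c 0)
  obtain ⟨F, -, hF⟩ := (S.isQuotientCoveringMap_projM.isCoveringMap.existsUnique_continuousMap_lifts
    ⟨c, hcont⟩ 0 z₀ hz₀).exists
  have hF' : S.projM ∘ F = c := hF
  have hd : ∀ t, HasMFDerivAt 𝓘(ℝ, ℝ) (model n) F t ((1 : ℝ →L[ℝ] ℝ).smulRight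
      ((κ * (F t).1, flowGenerator (𝓡 n) ψ (F t).2) : ℝ × EuclideanSpace ℝ (Fin n))) := by
    intro t
    have h1 := ((S.isLocalDiffeomorph_projM (F t)).mdifferentiableAt_of_comp (f := F) (x := t)
      (by simp) F.continuous.continuousAt
      (by rw [hF']; exact (hc t).mdifferentiableAt)).hasMFDerivAt
    have h2 := (S.contMDiff_projM.mdifferentiableAt (x := F t) (by simp)).hasMFDerivAt.comp t h1
    rw [hF'] at h2
    have h3 := congrArg (fun l : ℝ →L[ℝ] ℝ × EuclideanSpace ℝ (Fin n) => l 1)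
      (h2.mfderiv.symm.trans (hc t).mfderiv)
    have h4 := h3.trans (one_smulRight_apply_one (E := ℝ × EuclideanSpace ℝ (Fin n)) _)
    have h5 : c t = S.projM (F t) := (congrFun hF t).symm
    rw [h5] at h4
    -- The velocity of the lift and the lifted field have the same image under the injective
    -- differential of the projection, hence coincide.
    have h6 := S.mfderiv_projM_injective (F t) (h4.trans (S.flowGenerator_suspFlow κ hψ hs (F t)))
    have h7 : (1 : ℝ →L[ℝ] ℝ).smulRight
        ((κ * (F t).1, flowGenerator (𝓡 n) ψ (F t).2) : ℝ × EuclideanSpace ℝ (Fin n)) =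
        (mfderiv 𝓘(ℝ, ℝ) (model n) F t : ℝ →L[ℝ] ℝ × EuclideanSpace ℝ (Fin n)) :=
      ContinuousLinearMap.ext_ring ((one_smulRight_apply_one
        (E := ℝ × EuclideanSpace ℝ (Fin n)) _).trans h6.symm)
    exact (congrArg (HasMFDerivAt 𝓘(ℝ, ℝ) (model n) F t) h7).mpr h1
  refine ⟨fun t => (F t).1, fun t => (F t).2, fun t => (congrFun hF t).symm, fun t => ?_,
    fun t => ?_⟩
  · have h1 := (hasMFDerivAt_fst (I := 𝓘(ℝ, ℝ)) (I' := 𝓡 n) (F t)).comp t (hd t)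
    have h2 : HasFDerivAt (fun t => (F t).1) ((1 : ℝ →L[ℝ] ℝ).smulRight (κ * (F t).1)) t :=
      h1.hasFDerivAt
    simpa using h2.hasDerivAt
  · have h1 := (hasMFDerivAt_snd (I := 𝓘(ℝ, ℝ)) (I' := 𝓡 n) (F t)).comp t (hd t)
    exact h1

end HomothetyRep

/-- The function `e^{-κt} x t` has zero derivative. -/
theorem eq_exp_mul_of_hasDerivAt {κ : ℝ} {x : ℝ → ℝ} (hx : ∀ t, HasDerivAt x (κ * x t) t) (t : ℝ) :
    x t = Real.exp (t * κ) * x 0 := by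
  have h : ∀ t, HasDerivAt (fun t => Real.exp (-(t * κ)) * x t) 0 t := by
    intro t
    have h := (((hasDerivAt_id t).mul_const κ).neg.exp).mul (hx t)
    exact h.congr_deriv (by simp; ring)
  have h1 := is_const_of_deriv_eq_zero (fun t => (h t).differentiableAt) (fun t => (h t).deriv) t 0
  simp only [zero_mul, neg_zero, Real.exp_zero, one_mul] at h1
  rw [← h1, ← mul_assoc, ← Real.exp_add]
  simp

/-- A smooth flow fixes the zeros of its generator. -/
theorem IsSmoothFlow.eq_of_flowGenerator_eq_zero {E : Type*} [NormedAddCommGroup E]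
    [NormedSpace ℝ E] [CompleteSpace E] {H : Type*} [TopologicalSpace H]
    {I : ModelWithCorners ℝ E H} [I.Boundaryless]
    {M : Type*} [TopologicalSpace M] [ChartedSpace H M] [IsManifold I ∞ M] [T2Space M]
    {φ : ℝ → M → M} (h : IsSmoothFlow I φ) {p : M} (hp : flowGenerator I φ p = 0) (t : ℝ) :
    φ t p = p := by
  have : IsManifold I 1 M := IsManifold.of_le (n := ∞) (by simp)
  have h1 := isMIntegralCurve_Ioo_eq_of_contMDiff_boundaryless (t₀ := 0)
    (h.isSmoothField.of_le (by simp)) (h.isFlowOf.isMIntegralCurve p)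
    (isMIntegralCurve_const hp) (h.map_zero p)
  exact congrFun h1 t

/-! ### Zeros and closed orbits of the suspension -/

namespace HomothetyRep

variable {n : ℕ}
  {L : Type*} [TopologicalSpace L] [ChartedSpace (EuclideanSpace ℝ (Fin n)) L]
  {Lt : Type*} [TopologicalSpace Lt] [ChartedSpace (EuclideanSpace ℝ (Fin n)) Lt]
  [IsManifold (𝓡 n) ∞ Lt] [ConnectedSpace Lt]
  (S : HomothetyRep n L Lt) {κ : ℝ} {φ : ℝ → L → L} {ψ : ℝ → Lt → Lt}

/-- The zeros of the suspension of a flow lie over the zeros of the flow, in the compact leaf. -/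
theorem flowGenerator_suspFlow_eq_zero_iff (hκ : κ ≠ 0) (hs : IsSmoothFlow (𝓡 n) ψ)
    (hψ : ∀ (T : S.Γ) t y, ψ t (T.1 y) = T.1 (ψ t y)) (z : ℝ × Lt) :
    flowGenerator (model n) (S.suspFlow κ hψ) (S.projM z) = 0 ↔
      z.1 = 0 ∧ flowGenerator (𝓡 n) ψ z.2 = 0 := by
  rw [S.flowGenerator_suspFlow κ hψ hs]
  refine (map_eq_zero_iff _ (S.mfderiv_projM_injective z)).trans ?_
  refine (Prod.ext_iff (α := ℝ) (β := EuclideanSpace ℝ (Fin n))).trans ?_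
  exact and_congr (mul_eq_zero.trans (or_iff_right hκ)) Iff.rfl

/-- Although `zeroSection` is defined by choosing preimages, its composite with the local
diffeomorphism `proj` is the smooth map `y ↦ [0, y]`. -/
theorem contMDiff_zeroSection [ConnectedSpace L] :
    ContMDiff (𝓡 n) (model n) ∞ S.zeroSection := by
  intro y
  obtain ⟨y, rfl⟩ := S.proj_surjective y
  refine (S.isLocalDiffeomorph y).contMDiffAt_of_comp_right ?_
  have h : S.zeroSection ∘ S.proj = S.projM ∘ fun y => ((0 : ℝ), y) := funext S.zeroSection_proj
  rw [h]
  exact (S.contMDiff_projM.comp (contMDiff_const.prodMk contMDiff_id)) y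

/-- `Y` is the generator of the suspension of the stationary flow on `Lt`. -/
theorem isSmoothField_Y (κ : ℝ) : IsSmoothField (model n) (S.Y κ) := by
  have hid : IsSmoothFlow (𝓡 n) (fun (_ : ℝ) (y : Lt) => y) :=
    ⟨contMDiff_snd, fun _ => rfl, fun _ _ _ => rfl⟩
  have h0 : ∀ y : Lt, flowGenerator (𝓡 n) (fun (_ : ℝ) (y : Lt) => y) y = 0 := fun y =>
    congrArg (fun l : ℝ →L[ℝ] EuclideanSpace ℝ (Fin n) => l 1) (mfderiv_const ..)
  have h1 := (S.isSmoothFlow_suspFlow κ (fun _ _ _ => rfl) hid).isSmoothField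
  have h2 : flowGenerator (model n) (S.suspFlow κ (ψ := fun (_ : ℝ) (y : Lt) => y)
      (fun _ _ _ => rfl)) = S.Y κ := by
    funext q
    obtain ⟨z, rfl⟩ := S.projM_surjective q
    rw [S.Y_projM, S.flowGenerator_suspFlow κ _ hid, h0]
    rfl
  rwa [h2] at h1

variable [IsManifold (𝓡 n) ∞ L] [T2Space L]

/-- The suspension of a flow without closed orbits, by nontrivial homotheties, has no closed
orbits. -/
theorem hasNoClosedOrbits_suspFlow (hκ : κ ≠ 0) (hφ : IsSmoothFlow (𝓡 n) φ)
    (hs : IsSmoothFlow (𝓡 n) ψ) (hl : ∀ t y, S.proj (ψ t y) = φ t (S.proj y))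
    (hψ : ∀ (T : S.Γ) t y, ψ t (T.1 y) = T.1 (ψ t y))
    (ho : HasNoClosedOrbits (𝓡 n) (flowGenerator (𝓡 n) φ)) :
    HasNoClosedOrbits (model n) (flowGenerator (model n) (S.suspFlow κ hψ)) := by
  have : IsManifold (𝓡 n) 1 L := IsManifold.of_le (n := ∞) (by simp)
  intro c hc τ hτ hcτ
  obtain ⟨x, y, hxy, hx, hy⟩ := S.exists_lift_integralCurve hψ hs hc
  have hπ : ∀ u, mfderiv (𝓡 n) (𝓡 n) S.proj u (flowGenerator (𝓡 n) ψ u) =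
      flowGenerator (𝓡 n) φ (S.proj u) := fun u =>
    hs.mfderiv_flowGenerator hl u (S.isLocalDiffeomorph.mdifferentiable (by simp) u)
  have hint : IsMIntegralCurve (I := 𝓡 n) (S.proj ∘ y) (flowGenerator (𝓡 n) φ) := by
    intro t
    have h1 := (S.isLocalDiffeomorph.mdifferentiable (by simp) (y t)).hasMFDerivAt.comp t (hy t)
    have h2 : (mfderiv (𝓡 n) (𝓡 n) S.proj (y t) : EuclideanSpace ℝ (Fin n) →L[ℝ]
        EuclideanSpace ℝ (Fin n)) ∘L ((1 : ℝ →L[ℝ] ℝ).smulRight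
          (flowGenerator (𝓡 n) ψ (y t) : EuclideanSpace ℝ (Fin n))) =
        (1 : ℝ →L[ℝ] ℝ).smulRight
          (flowGenerator (𝓡 n) φ (S.proj (y t)) : EuclideanSpace ℝ (Fin n)) := by
      refine ContinuousLinearMap.ext_ring ?_
      refine Eq.trans ?_ (one_smulRight_apply_one (E := EuclideanSpace ℝ (Fin n)) _).symm
      refine Eq.trans ?_ (hπ (y t))
      exact congrArg (mfderiv (𝓡 n) (𝓡 n) S.proj (y t))
        (one_smulRight_apply_one (E := EuclideanSpace ℝ (Fin n)) _)
    exact (congrArg (HasMFDerivAt 𝓘(ℝ, ℝ) (𝓡 n) (S.proj ∘ y) t) h2).mp h1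
  rw [hxy, hxy] at hcτ
  -- The lifted curve need not close up: its endpoints differ by some `T`, which is invisible after
  -- projecting to `L`.
  obtain ⟨T, hT⟩ := S.projM_eq_iff.1 hcτ
  have hT2 : T.1 (y 0) = y τ := congrArg Prod.snd hT
  have hzero : flowGenerator (𝓡 n) φ (S.proj (y 0)) = 0 := by
    refine ho _ hint τ hτ ?_
    change S.proj (y τ) = S.proj (y 0)
    rw [← hT2]
    exact T.2 _
  have hconst : S.proj ∘ y = fun _ => S.proj (y 0) :=
    isMIntegralCurve_Ioo_eq_of_contMDiff_boundaryless (t₀ := 0) (hφ.isSmoothField.of_le (by simp))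
      hint (isMIntegralCurve_const hzero) rfl
  have hyc : Continuous y := continuous_iff_continuousAt.2 fun t => (hy t).continuousAt
  -- A lift of a constant path is constant, so `T` fixes `y 0` and freeness gives `T = 1`.
  have hyconst : y = fun _ => y 0 := S.isCoveringMap.eq_of_comp_eq hyc continuous_const hconst 0 rfl
  have hT1 : T = 1 := S.eq_one_of_deck_fixed (hT2.trans (congrFun hyconst τ))
  have hx0 : x 0 = 0 := by
    rw [hT1, one_smul] at hT
    have h1 : x 0 = x τ := congrArg Prod.fst hT
    have h2 := eq_exp_mul_of_hasDerivAt hx τ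
    rw [← h1] at h2
    have h3 : (Real.exp (τ * κ) - 1) * x 0 = 0 := by linarith
    rcases mul_eq_zero.1 h3 with h4 | h4
    · have h5 : τ * κ = 0 := Real.exp_eq_one_iff _ |>.1 (by linarith)
      exact absurd h5 (mul_ne_zero hτ.ne' hκ)
    · exact h4
  have hy0 : flowGenerator (𝓡 n) ψ (y 0) = 0 := by
    refine (S.isLocalDiffeomorph (y 0)).mfderiv_injective (by simp) ?_
    rw [hπ, hzero, map_zero]
  rw [hxy, S.flowGenerator_suspFlow κ hψ hs, hx0, hy0, mul_zero]
  exact map_zero _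

/-- Both `projM` and `proj` are local diffeomorphisms intertwining the flows, so simplicity may be
checked on `ℝ × Lt`, where the fixed point is the product of the origin of the homothety flow with a
lift of a zero of `A`. -/
theorem isSimpleFixedPoint_suspFlow (hκ : κ ≠ 0) (hφ : IsSmoothFlow (𝓡 n) φ)
    (hs : IsSmoothFlow (𝓡 n) ψ) (hl : ∀ t y, S.proj (ψ t y) = φ t (S.proj y))
    (hψ : ∀ (T : S.Γ) t y, ψ t (T.1 y) = T.1 (ψ t y))
    (hsimple : ∀ p, flowGenerator (𝓡 n) φ p = 0 → IsSimpleFixedPoint (𝓡 n) φ p) (q : S.M)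
    (hq : flowGenerator (model n) (S.suspFlow κ hψ) q = 0) :
    IsSimpleFixedPoint (model n) (S.suspFlow κ hψ) q := by
  obtain ⟨⟨x, y⟩, rfl⟩ := S.projM_surjective q
  obtain ⟨hx, hy⟩ := (S.flowGenerator_suspFlow_eq_zero_iff hκ hs hψ _).1 hq
  obtain rfl : x = 0 := hx
  have hπy : flowGenerator (𝓡 n) φ (S.proj y) = 0 := by
    rw [← hs.mfderiv_flowGenerator hl y (S.isLocalDiffeomorph.mdifferentiable (by simp) y), hy,
      map_zero]
  have hfix : ∀ t, ψ t y = y := congrFun (S.isCoveringMap.eq_of_comp_eq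
    (hs.contMDiff_orbit y).continuous continuous_const
    (funext fun t => (hl t y).trans (hφ.eq_of_flowGenerator_eq_zero hπy t)) 0 (hs.map_zero y))
  have h1 : IsSimpleFixedPoint (𝓡 n) ψ y :=
    (isSimpleFixedPoint_iff_of_isLocalDiffeomorphAt hs hφ hl (S.isLocalDiffeomorph y) hfix).2
      (hsimple _ hπy)
  have hprod := (isSmoothFlow_homothety κ).prod hs
  exact (isSimpleFixedPoint_iff_of_isLocalDiffeomorphAt hprod (S.isSmoothFlow_suspFlow κ hψ hs)
    (fun t z => (S.suspFlow_projM κ hψ t z).symm) (S.isLocalDiffeomorph_projM (0, y))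
    (fun t => Prod.ext (mul_zero _) (hfix t))).1
    (IsSimpleFixedPoint.prod (isSmoothFlow_homothety κ) hs (isSimpleFixedPoint_homothety hκ) h1)

end HomothetyRep

/-! ### The theorem -/

theorem propositionp {n : ℕ}
    {L : Type*} [TopologicalSpace L] [ChartedSpace (EuclideanSpace ℝ (Fin n)) L]
    [IsManifold (𝓡 n) ∞ L] [T2Space L] [CompactSpace L] [ConnectedSpace L]
    {Lt : Type*} [TopologicalSpace Lt] [ChartedSpace (EuclideanSpace ℝ (Fin n)) Lt]
    [IsManifold (𝓡 n) ∞ Lt] [ConnectedSpace Lt]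
    (S : HomothetyRep n L Lt) (κ : ℝ) (hκ : κ ≠ 0)
    (A : (y : L) → TangentSpace (𝓡 n) y) (hA : IsSmoothField (𝓡 n) A)
    (hA_simple : IsSimpleField (𝓡 n) A) (hA_orbits : HasNoClosedOrbits (𝓡 n) A) :
    ∃ B : (q : S.M) → TangentSpace (HomothetyRep.model n) q,
      S.IsFoliated B ∧
      IsCompleteField (HomothetyRep.model n) B ∧
      IsSimpleField (HomothetyRep.model n) B ∧
      HasNoClosedOrbits (HomothetyRep.model n) B ∧
      S.IsLeafwise (fun q => B q - S.Y κ q) ∧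
      ∀ y : L, B (S.zeroSection y) =
        mfderiv (𝓡 n) (HomothetyRep.model n) S.zeroSection y (A y) := by
  obtain ⟨φ, hAφ, hfix, -⟩ := hA_simple
  obtain rfl : A = flowGenerator (𝓡 n) φ := funext hAφ.eq_flowGenerator
  have hφ := hAφ.isSmoothFlow
  obtain ⟨ψ, hs, hl, hψ⟩ := S.exists_lift_smoothFlow hφ
  have hΨ := S.isSmoothFlow_suspFlow κ hψ hs
  have hB := hΨ.isFlowOf
  have hgen := S.flowGenerator_suspFlow κ hψ hs
  have hclosed := S.hasNoClosedOrbits_suspFlow hκ hφ hs hl hψ hA_orbits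
  refine ⟨flowGenerator (HomothetyRep.model n) (S.suspFlow κ hψ),
    S.isFoliated_of_fst (κ := κ) hΨ.isSmoothField fun z => ⟨_, rfl, (hgen z).symm⟩,
    fun q => ⟨_, hΨ.map_zero q, hB.isMIntegralCurve q⟩,
    ⟨_, hB, S.isSimpleFixedPoint_suspFlow hκ hφ hs hl hψ hfix, fun q hq ℓ hℓ => absurd ?_ hq⟩,
    hclosed, ⟨hΨ.isSmoothField.sub_section (S.isSmoothField_Y κ), fun z => ?_⟩, fun y => ?_⟩
  -- A nonzero point with a positive period would lie on a closed orbit, so the condition on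
  -- periodic points is vacuous.
  · have h := hclosed _ (hB.isMIntegralCurve q) ℓ hℓ.1.1 (hℓ.1.2.trans (hΨ.map_zero q).symm)
    rwa [hΨ.map_zero q] at h
  · refine S.mem_leafTangent_iff.2 ⟨(0, flowGenerator (𝓡 n) ψ z.2), rfl, ?_⟩
    refine Eq.trans ?_ (congrArg₂ (fun v w : ℝ × EuclideanSpace ℝ (Fin n) => v - w)
      (hgen z) (S.Y_projM κ z)).symm
    refine Eq.trans (congrArg (mfderiv (HomothetyRep.model n) (HomothetyRep.model n) S.projM z) ?_)
      (map_sub _ _ _)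
    -- On `ℝ × Lt` this is `(0, Ã) = (κ x, Ã) - (κ x, 0)`.
    exact Prod.ext (sub_self _).symm (sub_zero _).symm
  -- The zero section intertwines `φ` with the suspension flow, since `e^{tκ} · 0 = 0`, so it
  -- relates their generators.
  · refine (hφ.mfderiv_flowGenerator (fun t y => ?_) y
      (S.contMDiff_zeroSection.mdifferentiableAt (by simp))).symm
    obtain ⟨u, rfl⟩ := S.proj_surjective y
    rw [← hl, S.zeroSection_proj, S.zeroSection_proj, S.suspFlow_projM, mul_zero]
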